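/- Write $\mathbb R^3_-=\{x\in\mathbb R^3: x_3<0\}$. Let $A_1,A_2\in W^{1,\infty}_{comp}(\overline{\mathbb R^3_-},\mathbb R^3)$, i.e. each $A_j$ is the restriction to $\overline{\mathbb R^3_-}$ of a compactly supported field in $W^{1,\infty}(\mathbb R^3,\mathbb R^3)$ (continuous representative), and assume that the third component of $A_j$ vanishes on $\{x_3=0\}$. Let $B$ be an open ball centered on $\{x_3=0\}$ that contains $\operatorname{supp}A_1\cup\operatorname{supp}A_2$. Let $\tilde A_j$ be the extension of $A_j$ to $\mathbb R^3$ by reflection in $\{x_3=0\}$, even in the first two components and odd in the third. Call $(\gamma_1,\gamma_2,\xi)\in(\mathbb R^3)^3$ admissible if $|\gamma_1|=|\gamma_2|=1$, the vectors $\gamma_1,\gamma_2,\xi$ are pairwise orthogonal, $\gamma_{1,3}=0$ and $\gamma_{2,3}\neq0$. For orthonormal $\alpha,\beta$ and a compactly supported field $A$ put $$\Phi^0[\alpha,\beta,A](x)=\frac1{2\pi}\int_{\mathbb R^2}\frac{-i(\alpha+i\beta)\cdot A(x-s_1\alpha-s_2\beta)}{s_1+is_2}\,ds_1ds_2 ,$$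 the solution of $(\alpha+i\beta)\cdot\nabla\Phi^0=-i(\alpha+i\beta)\cdot A$ given by the Cauchy operator, and let $\Phi_1^0=\Phi^0[\gamma_1,\gamma_2,\tilde A_1]$, $\Phi_2^0=\Phi^0[-\gamma_1,\gamma_2,\tilde A_2]$. An amplitude for $(\gamma_1,\gamma_2)$ is a function $g\in C^\infty(\overline B)$ with $(\gamma_1+i\gamma_2)\cdot\nabla g=0$ in $B$. Then: (i) For every admissible $(\gamma_1,\gamma_2,\xi)$, the equality $$(\gamma_1+i\gamma_2)\cdot\int_B(\tilde A_2-\tilde A_1)\,e^{ix\cdot\xi}e^{\Phi_1^0+\overline{\Phi_2^0}}\,dx=0\tag{1}$$ implies $$(\gamma_1+i\gamma_2)\cdot\int_B(\tilde A_2-\tilde A_1)\,e^{ix\cdot\xi}\,dx=0 .$$ (ii) If (1) holds for all admissible $(\gamma_1,\gamma_2,\xi)$, then for all admissible $(\gamma_1,\gamma_2,\xi)$ and all amplitudes $g$ for $(\gamma_1,\gamma_2)$, $$(\gamma_1+i\gamma_2)\cdot\int_B(\tilde A_2-\tilde A_1)\,g\,e^{ix\cdot\xi}e^{\Phi_1^0+\overline{\Phi_2^0}}\,dx=0.\tag{2}$$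 (iii) Let $\gamma_1,\gamma_2$ be fixed. If (2) holds for all $\xi$ with $(\gamma_1,\gamma_2,\xi)$ admissible and all amplitudes $g$ for $(\gamma_1,\gamma_2)$, then for all such $\xi$ and $g$, $$(\gamma_1+i\gamma_2)\cdot\int_B(\tilde A_2-\tilde A_1)\,g\,e^{ix\cdot\xi}\,dx=0 .$$ -/

import Mathlib

open MeasureTheory Metric
open scoped ContDiff

noncomputable section

namespace MagneticHalfSpace

/-- Three-dimensional Euclidean space; the coordinates `x 0, x 1, x 2` are `x₁, x₂, x₃`. -/
abbrev E3 : Type := EuclideanSpace ℝ (Fin 3)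

/-- The closed lower half space `x₃ ≤ 0`. -/
def lowerHalf : Set E3 := {x | x 2 ≤ 0}

/-- `g` is the weak `k`-th partial derivative of `f` on the whole space. -/
def HasWeakPartial (f g : E3 → ℝ) (k : Fin 3) : Prop :=
  ∀ φ : E3 → ℝ, ContDiff ℝ ∞ φ → HasCompactSupport φ →
    ∫ x, f x * fderiv ℝ φ x (EuclideanSpace.single k 1) = -∫ x, g x * φ x

/-- The Sobolev space `W^{1,∞}` on the whole space, for real-valued functions. -/
def MemW1Inf (f : E3 → ℝ) : Prop :=
  MemLp f ⊤ volume ∧ ∀ k : Fin 3, ∃ g : E3 → ℝ, MemLp g ⊤ volume ∧ HasWeakPartial f g k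

/-- `A`, as a field on the closed lower half space, is the restriction of a compactly supported
`W^{1,∞}` vector field on the whole space. As values on the boundary plane are used, the field is
represented by its continuous representative. Values of `A` at `x₃ > 0` play no role. -/
def MemW1InfComp (A : E3 → E3) : Prop :=
  ∃ A' : E3 → E3, Continuous A' ∧ HasCompactSupport A' ∧ (∀ k : Fin 3, MemW1Inf fun x => A' x k) ∧
    ∀ x ∈ lowerHalf, A x = A' x

/-- The support of `A` as a field on the closed lower half space. -/
def lowerSupport (A : E3 → E3) : Set E3 := closure (lowerHalf ∩ Function.support A)

/-- The reflection `(x₁, x₂, x₃) ↦ (x₁, x₂, -x₃)`. -/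
def reflect (x : E3) : E3 := !₂[x 0, x 1, -x 2]

/-- The extension of `A` across `x₃ = 0`: even in the first two components, odd in the third. -/
def reflExt (A : E3 → E3) (x : E3) : E3 :=
  if x 2 ≤ 0 then A x else reflect (A (reflect x))

/-- A real vector regarded as a complex one. -/
def toC (v : E3) : Fin 3 → ℂ := fun k => (v k : ℂ)

/-- The complex vector `α + iβ`. -/
def zeta (α β : E3) : Fin 3 → ℂ := fun k => (α k : ℂ) + Complex.I * (β k : ℂ)

/-- The gradient of a complex-valued function. -/
def gradC (g : E3 → ℂ) (x : E3) : Fin 3 → ℂ :=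
  fun k => fderiv ℝ g x (EuclideanSpace.single k 1)

/-- The solution `Φ⁰` of `(α + iβ) · ∇Φ⁰ = -i (α + iβ) · A` given by the Cauchy operator in the
planes parallel to the span of `α` and `β`. -/
def cauchyPhase (α β : E3) (A : E3 → E3) (x : E3) : ℂ :=
  (1 / (2 * (Real.pi : ℂ))) * ∫ s : ℝ × ℝ,
    (-Complex.I * (zeta α β ⬝ᵥ toC (A (x - (s.1 • α + s.2 • β))))) /
      ((s.1 : ℂ) + Complex.I * (s.2 : ℂ))

/-- The function `Φ₁⁰ + conj Φ₂⁰`; `Φ₁⁰` belongs to `Ã₁` and `γ₁ + iγ₂`, and `Φ₂⁰` to `Ã₂` and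
`-γ₁ + iγ₂`. -/
def phaseSum (A₁ A₂ : E3 → E3) (γ₁ γ₂ : E3) (x : E3) : ℂ :=
  cauchyPhase γ₁ γ₂ (reflExt A₁) x +
    (starRingEnd ℂ) (cauchyPhase (-γ₁) γ₂ (reflExt A₂) x)

/-- `γ₁, γ₂` are unit vectors, `{γ₁, γ₂, ξ}` is orthogonal, `γ₁` is horizontal, `γ₂` is not. -/
def Admissible (γ₁ γ₂ ξ : E3) : Prop :=
  ‖γ₁‖ = 1 ∧ ‖γ₂‖ = 1 ∧ inner ℝ γ₁ γ₂ = 0 ∧ inner ℝ γ₁ ξ = 0 ∧ inner ℝ γ₂ ξ = 0 ∧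
    γ₁ 2 = 0 ∧ γ₂ 2 ≠ 0

/-- `g ∈ C^∞(closure B)` with `(γ₁ + iγ₂) · ∇g = 0` in the ball `B` of centre `c`, radius `R`. -/
def IsAmplitude (c : E3) (R : ℝ) (γ₁ γ₂ : E3) (g : E3 → ℂ) : Prop :=
  ContDiffOn ℝ ∞ g (closedBall c R) ∧ ∀ x ∈ ball c R, zeta γ₁ γ₂ ⬝ᵥ gradC g x = 0

/-- The number `(γ₁ + iγ₂) · ∫_B (Ã₂ - Ã₁) w(x) e^{i x·ξ} dx` for a scalar weight `w`. -/
def moment (c : E3) (R : ℝ) (A₁ A₂ : E3 → E3) (γ₁ γ₂ ξ : E3) (w : E3 → ℂ) : ℂ :=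
  zeta γ₁ γ₂ ⬝ᵥ fun k => ∫ x in ball c R,
    toC (reflExt A₂ x - reflExt A₁ x) k * w x * Complex.exp (Complex.I * (inner ℝ x ξ : ℝ))

end MagneticHalfSpace

end

open MagneticHalfSpace

/-! Let D be the difference of the reflected fields and put q = i(γ₁ + iγ₂)·D/(2π). On each plane
parallel to γ₁, γ₂ the phase Φ₁⁰ + conj Φ₂⁰ is exactly Tq, where Tq(w) = ∫ q(z)/(w - z). So every
moment is a Fourier transform, across the planes, of integrals ∫ q e^{Tq} g or ∫ q g. The planar
analysis needs no differentiation. The Rota–Baxter identity Tp·Tq = T(p·Tq) + T(q·Tp)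
(`cauchyT_mul_cauchyT`) gives (Tq)^{n+1} = (n+1) T(q (Tq)^n), and summing gives e^{Tq} - 1 = T(q
e^{Tq}) (`exp_cauchyT_sub_one`). Comparing the 1/w terms at infinity yields ∫ q e^{Tq} = ∫ q, which
is (i), for each frequency separately. All moments ∫ q zⁿ vanish iff Tq vanishes near infinity.
There e^{Tq} = 1 iff Tq = 0, since Tq is small, so the moments of q vanish iff those of q e^{Tq} do
(`forall_moment_exp_eq_zero_iff`). Vanishing moments annihilate every amplitude, because an
amplitude is holomorphic on each planar slice of the ball. Testing with g = zⁿ and inverting the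
Fourier transform proves (iii). For (ii), part (i) removes the exponential. Varying the frame then
shows that the Fourier transform of D at ξ is parallel to ξ unless ξ is vertical: D is curl free.
This relation continues to complex frequencies. At τb₀ + l(b₁ + ib₂) it says that the component of
the transform along γ₁ + iγ₂ vanishes, and the Taylor coefficients in l are the planar moments of q.
-/

namespace CauchyTransform

/-! ### The planar Cauchy transform and the Rota–Baxter identity -/

open Filter Topology

/-- Bounded measurable functions on the plane that vanish outside a disc. -/
structure IsDensity (q : ℂ → ℂ) : Prop where
  measurable : Measurable q
  bounded : ∃ M, ∀ z, ‖q z‖ ≤ M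
  support : ∃ r, ∀ z, r < ‖z‖ → q z = 0

/-- The Cauchy transform of a function on the plane. -/
noncomputable def cauchyT (q : ℂ → ℂ) (w : ℂ) : ℂ := ∫ z, q z / (w - z)

/-- The absolute value of the Cauchy kernel, cut off at the unit circle. -/
noncomputable def cutKernel : ℂ → ℝ := (ball (0 : ℂ) 1).indicator fun z => ‖z‖⁻¹

theorem integrable_cutKernel : Integrable cutKernel := by
  rw [cutKernel, integrable_indicator_iff measurableSet_ball]
  refine ⟨by fun_prop, ?_⟩
  rw [HasFiniteIntegral, ← lintegral_indicator measurableSet_ball,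
    ← Complex.lintegral_comp_polarCoord_symm]
  -- The polar Jacobian cancels the singularity, leaving the indicator of a bounded rectangle.
  have hle : ∀ p ∈ polarCoord.target, ENNReal.ofReal p.1 *
      (ball (0 : ℂ) 1).indicator (fun z => ‖‖z‖⁻¹‖ₑ) (Complex.polarCoord.symm p) ≤
      (Set.Ioo (0 : ℝ) 1 ×ˢ Set.Ioo (-Real.pi) Real.pi).indicator 1 p := by
    rintro ⟨a, b⟩ ⟨ha, hb⟩
    have ha' : 0 < a := ha
    have hn : ‖Complex.polarCoord.symm (a, b)‖ = a := by
      rw [Complex.norm_polarCoord_symm, abs_of_pos ha']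
    by_cases h1 : a < 1
    · rw [Set.indicator_of_mem (by simpa [hn, abs_of_pos ha'] using h1),
        Set.indicator_of_mem (by exact ⟨⟨ha', h1⟩, hb⟩), hn,
        Real.enorm_eq_ofReal (by positivity), ← ENNReal.ofReal_mul ha'.le,
        mul_inv_cancel₀ ha'.ne']
      simp
    · rw [Set.indicator_of_notMem (by simpa [hn, abs_of_pos ha'] using h1)]
      simp
  refine lt_of_le_of_lt (setLIntegral_mono' polarCoord.open_target.measurableSet hle) ?_
  refine lt_of_le_of_lt (setLIntegral_le_lintegral _ _) ?_
  rw [lintegral_indicator_one (measurableSet_Ioo.prod measurableSet_Ioo), Measure.volume_eq_prod,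
    Measure.prod_prod]
  simp

theorem cutKernel_nonneg (z : ℂ) : 0 ≤ cutKernel z :=
  Set.indicator_nonneg (fun _ _ => by positivity) z

theorem inv_norm_le_one_add_cutKernel (z : ℂ) : ‖z‖⁻¹ ≤ 1 + cutKernel z := by
  by_cases h : ‖z‖ < 1
  · rw [cutKernel, Set.indicator_of_mem (by simpa using h)]
    linarith
  · have := cutKernel_nonneg z
    have : ‖z‖⁻¹ ≤ 1 := inv_le_one_of_one_le₀ (not_lt.1 h)
    linarith

namespace IsDensity

variable {p q h : ℂ → ℂ}

theorem exists_pos_bounds (hq : IsDensity q) :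
    ∃ M r : ℝ, 0 < M ∧ 0 < r ∧ (∀ z, ‖q z‖ ≤ M) ∧ ∀ z, r < ‖z‖ → q z = 0 := by
  obtain ⟨M, hM⟩ := hq.bounded
  obtain ⟨r, hr⟩ := hq.support
  exact ⟨max M 1, max r 1, by positivity, by positivity, fun z => (hM z).trans (le_max_left _ _),
    fun z hz => hr z ((le_max_left _ _).trans_lt hz)⟩

theorem mul_bounded (hq : IsDensity q) (hm : Measurable h) (hb : ∃ M, ∀ z, ‖h z‖ ≤ M) :
    IsDensity fun z => q z * h z := by
  obtain ⟨M, r, hM0, -, hM, hr⟩ := hq.exists_pos_bounds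
  obtain ⟨N, hN⟩ := hb
  refine ⟨hq.measurable.mul hm, ⟨M * N, fun z => ?_⟩, ⟨r, fun z hz => by simp [hr z hz]⟩⟩
  rw [norm_mul]
  exact mul_le_mul (hM z) (hN z) (norm_nonneg _) hM0.le

theorem mul_of_bddOn (hq : IsDensity q) (hm : Measurable h)
    (hb : ∀ r : ℝ, ∃ M, ∀ z, ‖z‖ ≤ r → ‖h z‖ ≤ M) : IsDensity fun z => q z * h z := by
  obtain ⟨M, r, hM0, -, hM, hr⟩ := hq.exists_pos_bounds
  obtain ⟨N, hN⟩ := hb r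
  refine ⟨hq.measurable.mul hm, ⟨M * |N|, fun z => ?_⟩, ⟨r, fun z hz => by simp [hr z hz]⟩⟩
  rw [norm_mul]
  by_cases hz : r < ‖z‖
  · simp only [hr z hz, norm_zero, zero_mul]
    positivity
  · exact mul_le_mul (hM z) ((hN z (not_lt.1 hz)).trans (le_abs_self _)) (norm_nonneg _) hM0.le

theorem mul_pow (hq : IsDensity q) (n : ℕ) : IsDensity fun z => q z * z ^ n :=
  hq.mul_of_bddOn (by fun_prop) fun r => ⟨|r| ^ n, fun z hz => by
    rw [norm_pow]
    exact pow_le_pow_left₀ (norm_nonneg _) (hz.trans (le_abs_self _)) n⟩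

/-- By translation invariance the integral of this majorant does not depend on `w`, which makes all
later bounds uniform. -/
theorem _root_.CauchyTransform.norm_div_sub_le {M r : ℝ} (hM0 : 0 ≤ M) (hM : ∀ z, ‖q z‖ ≤ M)
    (hr : ∀ z, r < ‖z‖ → q z = 0) (w z : ℂ) : ‖q z / (w - z)‖ ≤
      M * ((closedBall (0 : ℂ) r).indicator 1 z + cutKernel (w - z)) := by
  by_cases hz : r < ‖z‖
  · rw [hr z hz, Set.indicator_of_notMem (by simpa using hz)]
    have := cutKernel_nonneg (w - z)
    simp only [zero_div, norm_zero]
    positivity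
  · rw [Set.indicator_of_mem (by simpa using hz), norm_div, div_eq_mul_inv]
    exact mul_le_mul (hM z) (inv_norm_le_one_add_cutKernel _) (by positivity) hM0

theorem integrable_indicator_add_cutKernel (r : ℝ) (w : ℂ) :
    Integrable fun z => (closedBall (0 : ℂ) r).indicator (1 : ℂ → ℝ) z + cutKernel (w - z) := by
  refine Integrable.add ?_ (integrable_cutKernel.comp_sub_left w)
  rw [integrable_indicator_iff measurableSet_closedBall]
  exact integrableOn_const measure_closedBall_lt_top.ne

theorem integrable_div_sub (hq : IsDensity q) (w : ℂ) : Integrable fun z => q z / (w - z) := by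
  obtain ⟨M, r, hM0, -, hM, hr⟩ := hq.exists_pos_bounds
  refine Integrable.mono' ((integrable_indicator_add_cutKernel r w).const_mul M) ?_
    (Eventually.of_forall (norm_div_sub_le hM0.le hM hr w))
  exact (hq.measurable.div (measurable_const.sub measurable_id)).aestronglyMeasurable

/-- The bound depends on the size and the support of the density only. -/
theorem exists_forall_integral_norm_le (M r : ℝ) :
    ∃ C, ∀ q : ℂ → ℂ, Measurable q → (∀ z, ‖q z‖ ≤ M) → (∀ z, r < ‖z‖ → q z = 0) →
      ∀ w, ∫ z, ‖q z / (w - z)‖ ≤ C := by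
  refine ⟨M * ((∫ z, (closedBall (0 : ℂ) r).indicator (1 : ℂ → ℝ) z) + ∫ z, cutKernel z),
    fun q hq hM hr w => ?_⟩
  have hM0 : 0 ≤ M := (norm_nonneg (q 0)).trans (hM 0)
  refine (integral_mono (integrable_div_sub ⟨hq, ⟨M, hM⟩, ⟨r, hr⟩⟩ w).norm
    ((integrable_indicator_add_cutKernel r w).const_mul M)
    (norm_div_sub_le hM0 hM hr w)).trans_eq ?_
  rw [integral_const_mul, integral_add _ (integrable_cutKernel.comp_sub_left w),
    integral_sub_left_eq_self]
  rw [integrable_indicator_iff measurableSet_closedBall]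
  exact integrableOn_const measure_closedBall_lt_top.ne

theorem exists_integral_norm_le (hq : IsDensity q) :
    ∃ C, ∀ w, ∫ z, ‖q z / (w - z)‖ ≤ C := by
  obtain ⟨M, r, -, -, hM, hr⟩ := hq.exists_pos_bounds
  obtain ⟨C, hC⟩ := exists_forall_integral_norm_le M r
  exact ⟨C, hC q hq.measurable hM hr⟩

theorem exists_norm_cauchyT_le (hq : IsDensity q) : ∃ C, ∀ w, ‖cauchyT q w‖ ≤ C := by
  obtain ⟨C, hC⟩ := hq.exists_integral_norm_le
  exact ⟨C, fun w => (norm_integral_le_integral_norm _).trans (hC w)⟩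

theorem measurable_cauchyT (hq : IsDensity q) : Measurable (cauchyT q) := by
  have : StronglyMeasurable (Function.uncurry fun w z : ℂ => q z / (w - z)) :=
    ((hq.measurable.comp measurable_snd).div
      (measurable_fst.sub measurable_snd)).stronglyMeasurable
  exact (this.integral_prod_right).measurable

theorem integrable (hq : IsDensity q) : Integrable q := by
  obtain ⟨M, r, -, -, hM, hr⟩ := hq.exists_pos_bounds
  have : IntegrableOn q (closedBall 0 r) :=
    Measure.integrableOn_of_bounded measure_closedBall_lt_top.ne hq.measurable.aestronglyMeasurable
      (Eventually.of_forall hM)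
  rwa [integrableOn_iff_integrable_of_support_subset] at this
  intro z hz
  by_contra hzr
  exact hz (hr z (by simpa using hzr))

theorem integrable_mul_div_sub_mul_sub (hp : IsDensity p) (hq : IsDensity q) (w : ℂ) :
    Integrable (fun y : ℂ × ℂ => p y.1 / (w - y.1) * (q y.2 / (y.1 - y.2)))
      (volume.prod volume) := by
  have hm : Measurable fun y : ℂ × ℂ => p y.1 / (w - y.1) * (q y.2 / (y.1 - y.2)) := by
    have := hp.measurable
    have := hq.measurable
    fun_prop
  rw [integrable_prod_iff hm.aestronglyMeasurable]
  refine ⟨Eventually.of_forall fun x => (hq.integrable_div_sub x).const_mul (p x / (w - x)), ?_⟩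
  obtain ⟨C, hC⟩ := hq.exists_integral_norm_le
  refine Integrable.mono' ((hp.integrable_div_sub w).norm.mul_const C)
    hm.stronglyMeasurable.norm.integral_prod_right.aestronglyMeasurable
    (Eventually.of_forall fun x => ?_)
  simp only [norm_mul, integral_const_mul, norm_norm]
  rw [Real.norm_of_nonneg (integral_nonneg fun _ => norm_nonneg _)]
  exact mul_le_mul_of_nonneg_left (hC x) (norm_nonneg _)

/-- The Rota–Baxter identity for the Cauchy transform. -/
theorem cauchyT_mul_cauchyT (hp : IsDensity p) (hq : IsDensity q) (w : ℂ) :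
    cauchyT p w * cauchyT q w =
      cauchyT (fun z => p z * cauchyT q z) w + cauchyT (fun z => q z * cauchyT p z) w := by
  have h1 := integrable_mul_div_sub_mul_sub hp hq w
  have h2 : Integrable (fun y : ℂ × ℂ => q y.2 / (w - y.2) * (p y.1 / (y.2 - y.1)))
      (volume.prod volume) := (integrable_mul_div_sub_mul_sub hq hp w).swap
  have e1 : cauchyT (fun z => p z * cauchyT q z) w =
      ∫ x, ∫ y, p x / (w - x) * (q y / (x - y)) := by
    refine integral_congr_ae (Eventually.of_forall fun x => ?_)
    simp only [cauchyT, integral_const_mul]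
    ring
  have e2 : cauchyT (fun z => q z * cauchyT p z) w =
      ∫ x, ∫ y, q y / (w - y) * (p x / (y - x)) := by
    rw [integral_integral_swap (f := fun x y => q y / (w - y) * (p x / (y - x))) h2]
    refine integral_congr_ae (Eventually.of_forall fun x => ?_)
    simp only [cauchyT, integral_const_mul]
    ring
  have e0 : cauchyT p w * cauchyT q w = ∫ x, ∫ y, p x / (w - x) * (q y / (w - y)) := by
    simp only [cauchyT, integral_const_mul, integral_mul_const]
  rw [e0, e1, e2]
  refine Eq.trans (integral_congr_ae ?_)
    (integral_add h1.integral_prod_left h2.integral_prod_left)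
  -- Off the null sets where two of the points coincide, the identity is the partial fraction
  -- decomposition 1/((w-x)(w-y)) = 1/((w-x)(x-y)) + 1/((w-y)(y-x)).
  have hne : ∀ a : ℂ, ∀ᵐ x : ℂ, x ≠ a := fun a => by simp [ae_iff]
  filter_upwards [hne w, h1.prod_right_ae, h2.prod_right_ae] with x hx i1 i2
  refine Eq.trans (integral_congr_ae ?_) (integral_add i1 i2)
  filter_upwards [hne w, hne x] with y hy hyx
  have a1 : w - x ≠ 0 := sub_ne_zero.2 hx.symm
  have a2 : w - y ≠ 0 := sub_ne_zero.2 hy.symm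
  have a3 : x - y ≠ 0 := sub_ne_zero.2 hyx.symm
  have a4 : y - x ≠ 0 := sub_ne_zero.2 hyx
  have : q y / (w - y) * (p x / (y - x)) = - (q y / (w - y) * (p x / (x - y))) := by
    rw [← neg_sub x y, div_neg, mul_neg]
  rw [this]
  field_simp
  ring

theorem mul_cauchyT_pow (hq : IsDensity q) (n : ℕ) :
    IsDensity fun z => q z * cauchyT q z ^ n := by
  obtain ⟨C, hC⟩ := hq.exists_norm_cauchyT_le
  refine hq.mul_bounded (hq.measurable_cauchyT.pow_const n) ⟨C ^ n, fun z => ?_⟩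
  rw [norm_pow]
  exact pow_le_pow_left₀ (norm_nonneg _) (hC z) n

theorem mul_exp_cauchyT (hq : IsDensity q) :
    IsDensity fun z => q z * Complex.exp (cauchyT q z) := by
  obtain ⟨C, hC⟩ := hq.exists_norm_cauchyT_le
  refine hq.mul_bounded (Complex.measurable_exp.comp hq.measurable_cauchyT)
    ⟨Real.exp C, fun z => ?_⟩
  rw [Complex.norm_exp]
  exact Real.exp_le_exp.2 ((Complex.re_le_norm _).trans (hC z))

theorem cauchyT_const_mul (c : ℂ) (q : ℂ → ℂ) (w : ℂ) :
    cauchyT (fun z => c * q z) w = c * cauchyT q w := by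
  simp only [cauchyT, mul_div_assoc, integral_const_mul]

/-- This plays the role of d(Fⁿ⁺¹) = (n+1) Fⁿ dF. In the induction the Rota–Baxter identity for q
and q (Tq)ⁿ produces T(q (Tq)ⁿ⁺¹) with the coefficient 1/(n+1) + 1. -/
theorem cauchyT_pow_succ (hq : IsDensity q) (n : ℕ) (w : ℂ) :
    cauchyT q w ^ (n + 1) = (n + 1) * cauchyT (fun z => q z * cauchyT q z ^ n) w := by
  induction n generalizing w with
  | zero => simp
  | succ n ih =>
    have hn : (n : ℂ) + 1 ≠ 0 := by exact_mod_cast n.succ_ne_zero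
    rw [pow_succ, ih, mul_assoc, mul_comm (cauchyT _ w) (cauchyT q w),
      hq.cauchyT_mul_cauchyT (hq.mul_cauchyT_pow n) w]
    have e1 : ∀ z, q z * cauchyT (fun z => q z * cauchyT q z ^ n) z =
        (n + 1 : ℂ)⁻¹ * (q z * cauchyT q z ^ (n + 1)) := fun z => by
      rw [ih z]
      field_simp
    have e2 : ∀ z, q z * cauchyT q z ^ n * cauchyT q z = q z * cauchyT q z ^ (n + 1) :=
      fun z => by ring
    simp only [e1, e2, cauchyT_const_mul]
    push_cast
    field_simp
    ring

/-- The formula for powers is summed over the exponential series; the uniform bound on Tq justifies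
termwise integration. It encodes the ∂̄-equation of e^{Tq} together with its limit 1 at infinity. -/
theorem exp_cauchyT_sub_one (hq : IsDensity q) (w : ℂ) :
    Complex.exp (cauchyT q w) - 1 = cauchyT (fun z => q z * Complex.exp (cauchyT q z)) w := by
  obtain ⟨C, hC⟩ := hq.exists_norm_cauchyT_le
  have hexp : ∀ x : ℂ, HasSum (fun n : ℕ => x ^ n / (n.factorial : ℂ)) (Complex.exp x) :=
    fun x => by
      rw [Complex.exp_eq_exp_ℂ]
      exact NormedSpace.expSeries_div_hasSum_exp x
  have h1 : HasSum (fun n : ℕ => cauchyT q w ^ (n + 1) / ((n + 1).factorial : ℂ))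
      (Complex.exp (cauchyT q w) - 1) := by
    simpa using (hasSum_nat_add_iff' 1).2 (hexp (cauchyT q w))
  have h2 : HasSum
      (fun n : ℕ => ∫ z, q z / (w - z) * (cauchyT q z ^ n / (n.factorial : ℂ)))
      (∫ z, q z / (w - z) * Complex.exp (cauchyT q z)) := by
    have hsum : HasSum (fun n : ℕ => C ^ n / (n.factorial : ℝ)) (Real.exp C) := by
      rw [Real.exp_eq_exp_ℝ]
      exact NormedSpace.expSeries_div_hasSum_exp C
    refine hasSum_integral_of_dominated_convergence
      (fun n z => ‖q z / (w - z)‖ * (C ^ n / (n.factorial : ℝ))) (fun n => ?_) (fun n => ?_)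
      ?_ ?_ ?_
    · have := hq.measurable
      have := hq.measurable_cauchyT
      exact Measurable.aestronglyMeasurable (by fun_prop)
    · refine Eventually.of_forall fun z => ?_
      rw [norm_mul, norm_div (_ ^ n), norm_pow]
      simp only [Complex.norm_natCast]
      gcongr
      exact hC z
    · exact Eventually.of_forall fun z => hsum.summable.mul_left _
    · simp only [tsum_mul_left]
      exact (hq.integrable_div_sub w).norm.mul_const _
    · exact Eventually.of_forall fun z => (hexp _).mul_left _
  have e : ∀ n : ℕ, ∫ z, q z / (w - z) * (cauchyT q z ^ n / (n.factorial : ℂ)) =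
      cauchyT q w ^ (n + 1) / ((n + 1).factorial : ℂ) := fun n => by
    have hn : (n : ℂ) + 1 ≠ 0 := by exact_mod_cast n.succ_ne_zero
    have hf : (n.factorial : ℂ) ≠ 0 := by exact_mod_cast n.factorial_ne_zero
    rw [hq.cauchyT_pow_succ, Nat.factorial_succ]
    have : ∀ z, q z / (w - z) * (cauchyT q z ^ n / (n.factorial : ℂ)) =
        q z * cauchyT q z ^ n / (w - z) * (n.factorial : ℂ)⁻¹ := fun z => by ring
    simp only [this, integral_mul_const]
    rw [cauchyT]
    push_cast
    field_simp
  simp only [e] at h2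
  rw [h1.unique h2, cauchyT]
  refine integral_congr_ae (Eventually.of_forall fun z => ?_)
  ring

end IsDensity

end CauchyTransform

/-! ### Behaviour at infinity and holomorphic moments -/

namespace CauchyTransform

open Filter Topology

namespace IsDensity

variable {q : ℂ → ℂ}

/-- From w/(w - z) = 1 + z/(w - z). Iterating it produces the moments one at a time. -/
theorem mul_cauchyT_eq (hq : IsDensity q) (w : ℂ) :
    w * cauchyT q w = (∫ z, q z) + cauchyT (fun z => q z * z) w := by
  have h1 : IsDensity fun z => q z * z := by simpa using hq.mul_pow 1
  rw [cauchyT, cauchyT, ← integral_const_mul, ← integral_add hq.integrable (h1.integrable_div_sub w)]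
  have hne : ∀ᵐ z : ℂ, z ≠ w := by simp [ae_iff]
  refine integral_congr_ae ?_
  filter_upwards [hne] with z hz
  have : w - z ≠ 0 := sub_ne_zero.2 hz.symm
  field_simp
  ring

theorem tendsto_cauchyT (hq : IsDensity q) : Tendsto (cauchyT q) (cocompact ℂ) (𝓝 0) := by
  have h1 : IsDensity fun z => q z * z := by simpa using hq.mul_pow 1
  obtain ⟨C, hC⟩ := h1.exists_norm_cauchyT_le
  have hlim : Tendsto (fun w : ℂ => (‖∫ z, q z‖ + C) / ‖w‖) (cocompact ℂ) (𝓝 0) :=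
    (tendsto_norm_cocompact_atTop (E := ℂ)).const_div_atTop _
  refine squeeze_zero_norm' ?_ hlim
  filter_upwards [(tendsto_norm_cocompact_atTop (E := ℂ)).eventually_gt_atTop 0] with w hw
  rw [le_div_iff₀ hw, mul_comm, ← norm_mul, hq.mul_cauchyT_eq]
  exact (norm_add_le _ _).trans (by gcongr; exact hC w)

theorem tendsto_mul_cauchyT (hq : IsDensity q) :
    Tendsto (fun w => w * cauchyT q w) (cocompact ℂ) (𝓝 (∫ z, q z)) := by
  have h1 : IsDensity fun z => q z * z := by simpa using hq.mul_pow 1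
  simpa [hq.mul_cauchyT_eq] using h1.tendsto_cauchyT.const_add (∫ z, q z)

/-- The limit of w·Tq(w) is the zeroth moment. Once it is zero, T(zq) = w·Tq also vanishes near
infinity, so the induction passes to zq. -/
theorem moment_eq_zero_of_cauchyT (hq : IsDensity q) (h : ∀ᶠ w in cocompact ℂ, cauchyT q w = 0)
    (n : ℕ) : ∫ z, q z * z ^ n = 0 := by
  induction n generalizing q with
  | zero =>
    have h0 : Tendsto (fun w => w * cauchyT q w) (cocompact ℂ) (𝓝 0) :=
      tendsto_const_nhds.congr' (by filter_upwards [h] with w hw; rw [hw, mul_zero])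
    simpa using tendsto_nhds_unique hq.tendsto_mul_cauchyT h0
  | succ n ih =>
    have h1 : IsDensity fun z => q z * z := by simpa using hq.mul_pow 1
    have h0 : Tendsto (fun w => w * cauchyT q w) (cocompact ℂ) (𝓝 0) :=
      tendsto_const_nhds.congr' (by filter_upwards [h] with w hw; rw [hw, mul_zero])
    have hint := tendsto_nhds_unique hq.tendsto_mul_cauchyT h0
    have := ih h1 (by
      filter_upwards [h] with w hw
      simpa [hw, hint] using (hq.mul_cauchyT_eq w).symm)
    simpa [mul_assoc, pow_succ'] using this

/-- Vanishing moments give wⁿ Tq(w) = T(zⁿ q)(w), hence |Tq(w)| ≤ C (r/|w|)ⁿ for every n, which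
tends to 0 when |w| > r. -/
theorem cauchyT_eq_zero_of_moment (hq : IsDensity q) (h : ∀ n : ℕ, ∫ z, q z * z ^ n = 0) :
    ∀ᶠ w in cocompact ℂ, cauchyT q w = 0 := by
  obtain ⟨M, r, hM0, hr0, hM, hr⟩ := hq.exists_pos_bounds
  filter_upwards [(tendsto_norm_cocompact_atTop (E := ℂ)).eventually_gt_atTop r] with w hw
  have hpow : ∀ n : ℕ, w ^ n * cauchyT q w = cauchyT (fun z => q z * z ^ n) w := fun n => by
    induction n with
    | zero => simp
    | succ n ih =>
      rw [pow_succ', mul_assoc, ih, (hq.mul_pow n).mul_cauchyT_eq, h n, zero_add]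
      simp only [mul_assoc, pow_succ]
  have hle : ∀ n : ℕ, ‖cauchyT q w‖ ≤ (r / ‖w‖) ^ n * ∫ z, ‖q z / (w - z)‖ := fun n => by
    have hw0 : 0 < ‖w‖ := hr0.trans hw
    rw [div_pow, div_mul_eq_mul_div, le_div_iff₀ (pow_pos hw0 n), mul_comm, ← norm_pow,
      ← norm_mul, hpow, ← integral_const_mul]
    refine norm_integral_le_of_norm_le ((hq.integrable_div_sub w).norm.const_mul _)
      (Eventually.of_forall fun z => ?_)
    by_cases hz : r < ‖z‖
    · simp [hr z hz]
    · rw [mul_div_right_comm, norm_mul, mul_comm, norm_pow]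
      gcongr
      exact not_lt.1 hz
  have hlim : Tendsto (fun n : ℕ => (r / ‖w‖) ^ n * ∫ z, ‖q z / (w - z)‖) atTop (𝓝 0) := by
    have := (tendsto_pow_atTop_nhds_zero_of_lt_one (r := r / ‖w‖) (by positivity)
      ((div_lt_one (hr0.trans hw)).2 hw)).mul_const (∫ z, ‖q z / (w - z)‖)
    simpa using this
  exact norm_le_zero_iff.1 (ge_of_tendsto' hlim hle)

/-- The exponential of the Cauchy transform does not change the integral. -/
theorem integral_mul_exp_cauchyT (hq : IsDensity q) :
    ∫ z, q z * Complex.exp (cauchyT q z) = ∫ z, q z := by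
  have h1 := hq.mul_exp_cauchyT.tendsto_mul_cauchyT
  simp only [← hq.exp_cauchyT_sub_one] at h1
  refine tendsto_nhds_unique h1 ?_
  -- Here |eᵘ - 1 - u| ≤ |u|² for |u| ≤ 1, while w·Tq stays bounded and Tq tends to 0.
  have h2 : Tendsto (fun w => w * (Complex.exp (cauchyT q w) - 1 - cauchyT q w)) (cocompact ℂ)
      (𝓝 0) := by
    have h3 : Tendsto (fun w => ‖w * cauchyT q w‖ * ‖cauchyT q w‖) (cocompact ℂ) (𝓝 0) := by
      simpa using hq.tendsto_mul_cauchyT.norm.mul hq.tendsto_cauchyT.norm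
    refine squeeze_zero_norm' ?_ h3
    have hs : ∀ᶠ w in cocompact ℂ, ‖cauchyT q w‖ < 1 := by
      have := hq.tendsto_cauchyT.norm
      rw [norm_zero] at this
      exact this.eventually_lt_const one_pos
    filter_upwards [hs] with w hw
    rw [norm_mul, norm_mul, mul_assoc, ← sq]
    gcongr
    exact Complex.norm_exp_sub_one_sub_id_le hw.le
  have := h2.add hq.tendsto_mul_cauchyT
  rw [zero_add] at this
  refine this.congr fun w => ?_
  ring

/-- All moments of a density vanish if and only if this holds after multiplication by the
exponential of its Cauchy transform. -/
theorem forall_moment_exp_eq_zero_iff (hq : IsDensity q) :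
    (∀ n : ℕ, ∫ z, q z * Complex.exp (cauchyT q z) * z ^ n = 0) ↔
      ∀ n : ℕ, ∫ z, q z * z ^ n = 0 := by
  constructor
  · intro h
    refine hq.moment_eq_zero_of_cauchyT ?_
    -- Smallness excludes the other solutions of eᵘ = 1: then |u| ≤ |u|², and |u| < 1/2 forces u =
    -- 0.
    have hs : ∀ᶠ w in cocompact ℂ, ‖cauchyT q w‖ < 1 / 2 := by
      have := hq.tendsto_cauchyT.norm
      rw [norm_zero] at this
      exact this.eventually_lt_const (by norm_num)
    filter_upwards [hq.mul_exp_cauchyT.cauchyT_eq_zero_of_moment h, hs] with w hw hw2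
    rw [← hq.exp_cauchyT_sub_one] at hw
    have h3 := Complex.norm_exp_sub_one_sub_id_le (hw2.le.trans (by norm_num : (1 / 2 : ℝ) ≤ 1))
    rw [hw, zero_sub, norm_neg] at h3
    refine norm_le_zero_iff.1 ?_
    nlinarith [norm_nonneg (cauchyT q w)]
  · intro h
    refine hq.mul_exp_cauchyT.moment_eq_zero_of_cauchyT ?_
    filter_upwards [hq.cauchyT_eq_zero_of_moment h] with w hw
    rw [← hq.exp_cauchyT_sub_one, hw, Complex.exp_zero, sub_self]

/-- A density with vanishing moments annihilates the functions that are holomorphic on a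
neighbourhood of a disc that carries it. -/
theorem integral_mul_eq_zero_of_differentiableOn (hq : IsDensity q)
    (h : ∀ n : ℕ, ∫ z, q z * z ^ n = 0) {ρ ρ' : ℝ} (hρ : ρ < ρ')
    (hsupp : ∀ z, ρ < ‖z‖ → q z = 0) {g : ℂ → ℂ} (hg : DifferentiableOn ℂ g (ball 0 ρ')) :
    ∫ z, q z * g z = 0 := by
  rcases lt_or_ge ρ 0 with h0 | h0
  · have : ∀ z, q z = 0 := fun z => hsupp z (h0.trans_le (norm_nonneg z))
    simp [this]
  -- With ρ < b < a < ρ', the Cauchy power series on radius a is dominated on the carrying disc by a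
  -- convergent series of radius b.
  obtain ⟨a, ha, haρ⟩ := exists_between hρ
  obtain ⟨b, hb, hbρ⟩ := exists_between ha
  lift a to NNReal using h0.trans ha.le
  lift b to NNReal using h0.trans hb.le
  have hps := (hg.mono (closedBall_subset_ball haρ)).hasFPowerSeriesOnBall
    (show 0 < a by exact_mod_cast h0.trans_lt ha)
  set p := cauchyPowerSeries g 0 a
  have hsum : ∀ z, HasSum (fun n : ℕ => q z * z ^ n * p.coeff n) (q z * g z) := fun z => by
    by_cases hz : ρ < ‖z‖
    · simp [hsupp z hz]
    have hmem : z ∈ eball (0 : ℂ) a := by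
      rw [Metric.eball_coe]
      simpa using (not_lt.1 hz).trans_lt (hb.trans hbρ)
    have := (hps.hasSum hmem).mul_left (q z)
    simpa only [zero_add, FormalMultilinearSeries.apply_eq_pow_smul_coeff, smul_eq_mul,
      ← mul_assoc] using this
  have hbr : (b : ENNReal) < p.radius :=
    lt_of_lt_of_le (by exact_mod_cast hbρ) hps.r_le
  have hint : HasSum (fun n : ℕ => ∫ z, q z * z ^ n * p.coeff n) (∫ z, q z * g z) := by
    refine hasSum_integral_of_dominated_convergence
      (fun n z => ‖q z‖ * (‖p n‖ * (b : ℝ) ^ n)) (fun n => ?_)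
      (fun n => Eventually.of_forall fun z => ?_) ?_ ?_ (Eventually.of_forall hsum)
    · exact ((hq.mul_pow n).measurable.mul_const _).aestronglyMeasurable
    · by_cases hz : ρ < ‖z‖
      · simp [hsupp z hz]
      · rw [norm_mul, norm_mul, norm_pow, mul_assoc, FormalMultilinearSeries.norm_apply_eq_norm_coef,
          mul_comm (‖z‖ ^ n)]
        gcongr
        exact (not_lt.1 hz).trans hb.le
    · exact Eventually.of_forall fun z => (p.summable_norm_mul_pow hbr).mul_left _
    · simp only [tsum_mul_left]
      exact hq.integrable.norm.mul_const _
  simp only [integral_mul_const, h, zero_mul] at hint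
  exact hint.unique hasSum_zero

end IsDensity

end CauchyTransform

namespace MagneticHalfSpace

open Filter Topology

/-! ### Uniqueness for the Fourier transform on the line -/

section Fourier

open FourierTransform SchwartzMap

/-- An integrable function on the line whose Fourier transform vanishes off the origin is zero
almost everywhere. -/
theorem ae_eq_zero_of_integral_mul_exp_eq_zero {m : ℝ → ℂ} (hm : Integrable m)
    (h : ∀ τ : ℝ, τ ≠ 0 → ∫ t, m t * Complex.exp (Complex.I * (τ * t)) = 0) :
    ∀ᵐ t, m t = 0 := by
  refine ae_eq_zero_of_integral_contDiff_smul_eq_zero hm.locallyIntegrable fun g hg hgs => ?_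
  have hgC : ContDiff ℝ ∞ fun t => (g t : ℂ) := Complex.ofRealCLM.contDiff.comp hg
  have hgsC : HasCompactSupport fun t => (g t : ℂ) := hgs.comp_left (g := Complex.ofReal) rfl
  -- The test function is the Fourier transform of a Schwartz function ψ, and self-adjointness moves
  -- the transform onto `m`.
  set φ : 𝓢(ℝ, ℂ) := hgsC.toSchwartzMap hgC
  set ψ : 𝓢(ℝ, ℂ) := 𝓕⁻ φ
  have hψ : ∀ t, 𝓕 (ψ : ℝ → ℂ) t = (g t : ℂ) := fun t => by
    rw [← SchwartzMap.fourier_coe]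
    simp only [ψ, FourierTransform.fourier_fourierInv_eq]
    rfl
  have hswap := VectorFourier.integral_fourierIntegral_smul_eq_flip (L := innerₗ ℝ)
    (μ := volume) (ν := volume) Real.continuous_fourierChar continuous_inner ψ.integrable hm
  have hl : ∀ t, VectorFourier.fourierIntegral Real.fourierChar volume (innerₗ ℝ) ψ t = g t :=
    fun t => hψ t
  have hr : ∀ᵐ τ : ℝ, ψ τ •
      VectorFourier.fourierIntegral Real.fourierChar volume (innerₗ ℝ).flip m τ = 0 := by
    have hne : ∀ᵐ τ : ℝ, τ ≠ 0 := by simp [ae_iff]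
    filter_upwards [hne] with τ hτ
    -- The factor -2π matches the normalisation e^{-2πiτt} of the Fourier integral.
    have := h (-(2 * Real.pi * τ)) (by simp [hτ, Real.pi_ne_zero])
    rw [VectorFourier.fourierIntegral, ← smul_zero (ψ τ), ← this]
    congr 1
    refine integral_congr_ae (Eventually.of_forall fun t => ?_)
    simp only [Circle.smul_def, Real.fourierChar_apply, smul_eq_mul, LinearMap.flip_apply,
      innerₗ_apply_apply]
    rw [mul_comm]
    congr 2
    simp
    ring
  simp only [hl] at hswap
  rw [integral_congr_ae hr, integral_zero] at hswap
  simpa using hswap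

end Fourier

/-! ### Entire functions defined by exponential integrals -/

section Entire

variable {α : Type*} [MeasurableSpace α] {μ : Measure α} {a θ : α → ℂ} {C : ℝ}

theorem integrable_mul_of_norm_le (ha : Integrable a μ) {b : α → ℂ}
    (hb : AEStronglyMeasurable b μ) (hC : ∀ x, a x ≠ 0 → ‖b x‖ ≤ C) :
    Integrable (fun x => a x * b x) μ := by
  refine Integrable.mono' (ha.norm.mul_const |C|) (ha.1.mul hb) (Eventually.of_forall fun x => ?_)
  rw [norm_mul]
  by_cases hx : a x = 0
  · simp [hx]
  · gcongr
    exact (hC x hx).trans (le_abs_self _)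

theorem integrable_mul_exp (ha : Integrable a μ) (hθ : AEStronglyMeasurable θ μ)
    (hC : ∀ x, a x ≠ 0 → ‖θ x‖ ≤ C) (l : ℂ) :
    Integrable (fun x => a x * Complex.exp (l * θ x)) μ := by
  refine integrable_mul_of_norm_le (C := Real.exp (‖l‖ * C)) ha
    (Complex.continuous_exp.comp_aestronglyMeasurable (hθ.const_mul l)) fun x hx => ?_
  rw [Complex.norm_exp]
  refine Real.exp_le_exp.2 ((Complex.re_le_norm _).trans ?_)
  rw [norm_mul]
  gcongr
  exact hC x hx

theorem hasDerivAt_integral_mul_exp (ha : Integrable a μ) (hθ : AEStronglyMeasurable θ μ)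
    (hC : ∀ x, a x ≠ 0 → ‖θ x‖ ≤ C) (l : ℂ) :
    HasDerivAt (fun l => ∫ x, a x * Complex.exp (l * θ x) ∂μ)
      (∫ x, a x * θ x * Complex.exp (l * θ x) ∂μ) l := by
  have haθ : Integrable (fun x => a x * θ x) μ := integrable_mul_of_norm_le ha hθ hC
  have hC' : ∀ x, a x * θ x ≠ 0 → ‖θ x‖ ≤ C := fun x hx => hC x (left_ne_zero_of_mul hx)
  refine (hasDerivAt_integral_of_dominated_loc_of_deriv_le (ball_mem_nhds l one_pos)
    (F' := fun l x => a x * θ x * Complex.exp (l * θ x))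
    (bound := fun x => ‖a x * θ x‖ * Real.exp ((‖l‖ + 1) * |C|))
    (Eventually.of_forall fun l' => (integrable_mul_exp ha hθ hC l').1)
    (integrable_mul_exp ha hθ hC l) (integrable_mul_exp haθ hθ hC' l).1
    (Eventually.of_forall fun x l' hl' => ?_) (haθ.norm.mul_const _)
    (Eventually.of_forall fun x l' _ => ?_)).2
  · rw [norm_mul]
    by_cases hx : a x = 0
    · simp [hx]
    gcongr
    rw [Complex.norm_exp]
    refine Real.exp_le_exp.2 ((Complex.re_le_norm _).trans ?_)
    rw [norm_mul]
    gcongr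
    · have := norm_sub_norm_le l' l
      rw [mem_ball_iff_norm] at hl'
      linarith
    · exact (hC x hx).trans (le_abs_self _)
  · have := (((hasDerivAt_id l').mul_const (θ x)).cexp).const_mul (a x)
    refine this.congr_deriv ?_
    simp only [id, one_mul]
    ring

/-- These integrals are the derivatives at l = 0 of the zero function. Each differentiation replaces
`a` by `a θ`. -/
theorem integral_mul_pow_eq_zero (ha : Integrable a μ) (hθ : AEStronglyMeasurable θ μ)
    (hC : ∀ x, a x ≠ 0 → ‖θ x‖ ≤ C) (h : ∀ l : ℂ, ∫ x, a x * Complex.exp (l * θ x) ∂μ = 0)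
    (n : ℕ) : ∫ x, a x * θ x ^ n ∂μ = 0 := by
  induction n generalizing a with
  | zero => simpa using h 0
  | succ n ih =>
    have := ih (integrable_mul_of_norm_le ha hθ hC) (fun x hx => hC x (left_ne_zero_of_mul hx))
      fun l => by
        have hd := hasDerivAt_integral_mul_exp ha hθ hC l
        simp only [h] at hd
        exact hd.unique (hasDerivAt_const l 0)
    simpa [pow_succ', mul_assoc] using this

/-- Identity theorem: the nonzero reals accumulate at 0. -/
theorem eq_zero_of_differentiable_of_real {F : ℂ → ℂ} (hF : Differentiable ℂ F)
    (h : ∀ s : ℝ, s ≠ 0 → F s = 0) (l : ℂ) : F l = 0 := by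
  have hA : AnalyticOnNhd ℂ F Set.univ := fun z _ => hF.analyticAt z
  have hfreq : ∃ᶠ z in 𝓝[≠] (0 : ℂ), F z = 0 := by
    have ht : Tendsto (fun s : ℝ => (s : ℂ)) (𝓝[≠] 0) (𝓝[≠] 0) := by
      refine tendsto_nhdsWithin_iff.2 ⟨?_, ?_⟩
      · exact (Complex.continuous_ofReal.tendsto' 0 0 (by simp)).mono_left nhdsWithin_le_nhds
      · filter_upwards [self_mem_nhdsWithin] with s hs
        simpa using hs
    refine ht.frequently (Eventually.frequently ?_)
    filter_upwards [self_mem_nhdsWithin] with s hs using h s hs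
  have := hA.eq_of_frequently_eq (g := fun _ => 0) (z₀ := 0) (fun z _ => analyticAt_const) hfreq
  exact congrFun this l

end Entire

end MagneticHalfSpace

/-! ### The reflected fields -/

namespace MagneticHalfSpace

open Filter Topology CauchyTransform

/-- Bounded measurable vector fields that vanish outside the closed ball of centre `c`,
radius `r`. -/
structure IsBoundedField (c : E3) (r : ℝ) (D : E3 → E3) : Prop where
  measurable : Measurable D
  bounded : ∃ M, ∀ x, ‖D x‖ ≤ M
  support : ∀ x, r < dist x c → D x = 0

theorem measurable_reflect : Measurable reflect := by
  unfold reflect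
  fun_prop

theorem norm_reflect (x : E3) : ‖reflect x‖ = ‖x‖ := by
  simp [reflect, EuclideanSpace.norm_eq, Fin.sum_univ_three]

theorem dist_reflect {c : E3} (hc : c 2 = 0) (x : E3) : dist (reflect x) c = dist x c := by
  simp [reflect, EuclideanSpace.dist_eq, Fin.sum_univ_three, Real.dist_eq, hc]

theorem isClosed_lowerHalf : IsClosed lowerHalf :=
  isClosed_le (by fun_prop) continuous_const

/-- A closed set inside the open ball lies in a smaller concentric ball, and reflection preserves
these balls because the centre is on the plane. The gap between `r` and `R` later gives amplitudes
room around the support. -/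
theorem exists_isBoundedField_reflExt {c : E3} {R : ℝ} (hc : c 2 = 0) {A : E3 → E3}
    (hA : MemW1InfComp A) (hB : lowerSupport A ⊆ ball c R) :
    ∃ r < R, IsBoundedField c r (reflExt A) := by
  obtain ⟨A', hcont, hcs, -, hAA'⟩ := hA
  obtain ⟨r, hr, hsub⟩ := exists_lt_subset_ball isClosed_closure hB
  obtain ⟨M, hM⟩ := hcs.exists_bound_of_continuous hcont
  have hz : ∀ x ∈ lowerHalf, r < dist x c → A x = 0 := fun x hx hxr => by
    by_contra h
    exact absurd (hsub (subset_closure ⟨hx, h⟩)) (by simpa using hxr.le)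
  have hrefl : ∀ x : E3, ¬ x 2 ≤ 0 → reflect x ∈ lowerHalf := fun x hx => by
    simpa [lowerHalf, reflect] using (not_le.1 hx).le
  have heq : reflExt A = fun x => if x 2 ≤ 0 then A' x else reflect (A' (reflect x)) := by
    funext x
    by_cases hx : x 2 ≤ 0
    · simp only [reflExt, if_pos hx, hAA' x hx]
    · simp only [reflExt, if_neg hx, hAA' _ (hrefl x hx)]
  refine ⟨r, hr, ?_, ⟨M, fun x => ?_⟩, fun x hxr => ?_⟩
  · rw [heq]
    exact Measurable.ite isClosed_lowerHalf.measurableSet hcont.measurable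
      (measurable_reflect.comp (hcont.measurable.comp measurable_reflect))
  · rw [heq]
    by_cases hx : x 2 ≤ 0
    · simpa only [if_pos hx] using hM x
    · simpa only [if_neg hx, norm_reflect] using hM (reflect x)
  · by_cases hx : x 2 ≤ 0
    · simpa only [reflExt, if_pos hx] using hz x hx hxr
    · simp only [reflExt, if_neg hx, hz _ (hrefl x hx) (by rwa [dist_reflect hc])]
      simp [reflect]

theorem IsBoundedField.sub {c : E3} {r₁ r₂ : ℝ} {D₁ D₂ : E3 → E3} (h₁ : IsBoundedField c r₁ D₁)
    (h₂ : IsBoundedField c r₂ D₂) : IsBoundedField c (max r₁ r₂) fun x => D₂ x - D₁ x := by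
  obtain ⟨M₁, hM₁⟩ := h₁.bounded
  obtain ⟨M₂, hM₂⟩ := h₂.bounded
  refine ⟨h₂.measurable.sub h₁.measurable, ⟨M₂ + M₁, fun x => ?_⟩, fun x hx => ?_⟩
  · exact (norm_sub_le _ _).trans (add_le_add (hM₂ x) (hM₁ x))
  · rw [h₁.support x ((le_max_left _ _).trans_lt hx), h₂.support x ((le_max_right _ _).trans_lt hx),
      sub_zero]

namespace IsBoundedField

variable {c : E3} {r R : ℝ} {D : E3 → E3}

theorem measurable_dotProduct (hD : IsBoundedField c r D) (v : Fin 3 → ℂ) :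
    Measurable fun x => v ⬝ᵥ toC (D x) := by
  have := hD.measurable
  simp only [dotProduct, toC]
  fun_prop

theorem dotProduct_eq_zero (hD : IsBoundedField c r D) (v : Fin 3 → ℂ) {x : E3}
    (hx : r < dist x c) : v ⬝ᵥ toC (D x) = 0 := by
  have : toC (0 : E3) = 0 := by ext; simp [toC]
  rw [hD.support x hx, this, dotProduct_zero]

theorem exists_norm_dotProduct_le (hD : IsBoundedField c r D) (v : Fin 3 → ℂ) :
    ∃ M, ∀ x, ‖v ⬝ᵥ toC (D x)‖ ≤ M := by
  obtain ⟨M, hM⟩ := hD.bounded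
  refine ⟨∑ k, ‖v k‖ * M, fun x => norm_sum_le_of_le _ fun k _ => ?_⟩
  rw [norm_mul]
  gcongr
  simpa [toC] using (PiLp.norm_apply_le (D x) k).trans (hM x)

theorem integrable_dotProduct_mul (hD : IsBoundedField c r D) (hr : r < R) (v : Fin 3 → ℂ)
    {w : E3 → ℂ} (hw : AEStronglyMeasurable w (volume.restrict (ball c R)))
    (hb : ∃ C, ∀ x ∈ ball c R, ‖w x‖ ≤ C) : Integrable fun x => (v ⬝ᵥ toC (D x)) * w x := by
  obtain ⟨C, hC⟩ := hb
  obtain ⟨M, hM⟩ := hD.exists_norm_dotProduct_le v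
  have : IntegrableOn (fun x => (v ⬝ᵥ toC (D x)) * w x) (ball c R) := by
    refine IntegrableOn.of_bound measure_ball_lt_top
      ((hD.measurable_dotProduct v).aestronglyMeasurable.mul hw) (M * C) ?_
    refine (ae_restrict_iff' measurableSet_ball).2 (Eventually.of_forall fun x hx => ?_)
    rw [norm_mul]
    exact mul_le_mul (hM x) (hC x hx) (norm_nonneg _) ((norm_nonneg _).trans (hM x))
  rwa [integrableOn_iff_integrable_of_support_subset] at this
  intro x hx
  by_contra hxR
  refine hx ?_
  simp only [hD.dotProduct_eq_zero v (hr.trans_le (not_lt.1 hxR)), zero_mul]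

end IsBoundedField

/-- The right hand side `i (γ₁ + iγ₂) · D` of the equation for the phase, divided by `2π`. -/
noncomputable def source (γ₁ γ₂ : E3) (D : E3 → E3) (x : E3) : ℂ :=
  Complex.I / (2 * Real.pi) * (zeta γ₁ γ₂ ⬝ᵥ toC (D x))

/-- The point with coordinates `t`, `Re z`, `Im z` with respect to the orthonormal frame `b` with
origin `c`. -/
noncomputable def framePoint (c : E3) (b : OrthonormalBasis (Fin 3) ℝ E3) (p : ℝ × ℂ) : E3 :=
  c + (p.1 • b 0 + p.2.re • b 1 + p.2.im • b 2)

/-- The complex coordinate in the planes spanned by `b 1`, `b 2`. -/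
noncomputable def planeCoord (c : E3) (b : OrthonormalBasis (Fin 3) ℝ E3) (x : E3) : ℂ :=
  (inner ℝ (b 1) (x - c) : ℝ) + Complex.I * (inner ℝ (b 2) (x - c) : ℝ)

/-! ### Coordinates in an orthonormal frame and slicing into planes -/

section Frame

variable (c : E3) (b : OrthonormalBasis (Fin 3) ℝ E3)

theorem inner_framePoint_sub (t : ℝ) (z : ℂ) :
    inner ℝ (b 0) (framePoint c b (t, z) - c) = t := by
  simp [framePoint, inner_add_right, inner_smul_right]

theorem planeCoord_framePoint (t : ℝ) (z : ℂ) : planeCoord c b (framePoint c b (t, z)) = z := by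
  simp [planeCoord, framePoint, inner_add_right, inner_smul_right, mul_comm Complex.I]

theorem dist_framePoint_sq (t : ℝ) (z : ℂ) :
    dist (framePoint c b (t, z)) c ^ 2 = t ^ 2 + ‖z‖ ^ 2 := by
  rw [dist_eq_norm, ← b.sum_sq_norm_inner_right (framePoint c b (t, z) - c), Fin.sum_univ_three,
    Complex.sq_norm, Complex.normSq_apply]
  simp [framePoint, inner_add_right, inner_smul_right]
  ring

theorem measurePreserving_framePoint : MeasurePreserving (framePoint c b) := by
  have h := (measurePreserving_add_left volume c).comp <|
    b.measurePreserving_repr_symm.comp <| (PiLp.volume_preserving_toLp (Fin 3)).comp <|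
    (volume_preserving_piFinSuccAbove (fun _ : Fin 3 => ℝ) 0).symm.comp <|
    (MeasurePreserving.id (volume : Measure ℝ)).prod Complex.volume_preserving_equiv_pi
  have e : framePoint c b = fun p => c + b.repr.symm (WithLp.toLp 2
      ((MeasurableEquiv.piFinSuccAbove (fun _ : Fin 3 => ℝ) 0).symm
        (p.1, Complex.measurableEquivPi p.2))) := by
    funext p
    simp only [framePoint, ← b.sum_repr_symm, Fin.sum_univ_three]
    rfl
  rw [e]
  exact h

variable {c b}

theorem integrable_comp_framePoint {h : E3 → ℂ} (hh : Integrable h) :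
    Integrable (fun p => h (framePoint c b p)) (volume.prod volume) :=
  ((measurePreserving_framePoint c b).integrable_comp hh.1).2 hh

theorem integral_eq_integral_framePoint {h : E3 → ℂ} (hh : Integrable h) :
    ∫ x, h x = ∫ t, ∫ z, h (framePoint c b (t, z)) := by
  rw [← (measurePreserving_framePoint c b).map_eq, integral_map
    (measurePreserving_framePoint c b).aemeasurable, Measure.volume_eq_prod]
  · exact integral_prod _ (integrable_comp_framePoint hh)
  · rw [(measurePreserving_framePoint c b).map_eq]
    exact hh.1

theorem integrable_integral_framePoint {h : E3 → ℂ} (hh : Integrable h) :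
    Integrable fun t => ∫ z, h (framePoint c b (t, z)) :=
  (integrable_comp_framePoint hh).integral_prod_left

theorem integral_mul_exp_eq {h : E3 → ℂ} (hh : Integrable h) (τ : ℝ) :
    ∫ x, h x * Complex.exp (Complex.I * (τ * (inner ℝ (b 0) (x - c) : ℝ))) =
      ∫ t : ℝ, (∫ z, h (framePoint c b (t, z))) * Complex.exp (Complex.I * (τ * t)) := by
  have hi : Integrable fun x =>
      h x * Complex.exp (Complex.I * (τ * (inner ℝ (b 0) (x - c) : ℝ))) := by
    refine hh.mul_bdd (c := 1) (Continuous.aestronglyMeasurable (by fun_prop))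
      (Eventually.of_forall fun x => ?_)
    rw [← Complex.ofReal_mul, mul_comm, Complex.norm_exp_ofReal_mul_I]
  rw [integral_eq_integral_framePoint (c := c) (b := b) hi]
  simp only [inner_framePoint_sub, integral_mul_const]

theorem ae_integral_framePoint_eq_zero {h : E3 → ℂ} (hh : Integrable h)
    (h0 : ∀ τ : ℝ, τ ≠ 0 →
      ∫ x, h x * Complex.exp (Complex.I * (τ * (inner ℝ (b 0) (x - c) : ℝ))) = 0) :
    ∀ᵐ t, ∫ z, h (framePoint c b (t, z)) = 0 :=
  ae_eq_zero_of_integral_mul_exp_eq_zero (integrable_integral_framePoint hh) fun τ hτ => by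
    rw [← integral_mul_exp_eq hh, h0 τ hτ]

end Frame

end MagneticHalfSpace

namespace MagneticHalfSpace

open Filter Topology CauchyTransform

/-! ### The phase as a planar Cauchy transform -/

section Phase

variable {c : E3} {b : OrthonormalBasis (Fin 3) ℝ E3} {r r₁ r₂ R : ℝ} {D : E3 → E3}

theorem framePoint_inner_planeCoord (x : E3) :
    framePoint c b (inner ℝ (b 0) (x - c), planeCoord c b x) = x := by
  have := b.sum_repr' (x - c)
  rw [Fin.sum_univ_three] at this
  simp only [framePoint, planeCoord, Complex.add_re, Complex.add_im, Complex.ofReal_re,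
    Complex.ofReal_im, Complex.re_mul_ofReal, Complex.im_mul_ofReal, Complex.I_re, Complex.I_im,
    zero_mul, one_mul, add_zero, zero_add, this, add_sub_cancel]

theorem framePoint_sub (t : ℝ) (w u : ℂ) :
    framePoint c b (t, w) - (u.re • b 1 + u.im • b 2) = framePoint c b (t, w - u) := by
  simp only [framePoint, Complex.sub_re, Complex.sub_im, sub_smul]
  abel

theorem measurable_framePoint : Measurable (framePoint c b) :=
  (measurePreserving_framePoint c b).measurable

theorem integral_real_prod_eq (F : ℝ × ℝ → ℂ) : ∫ s, F s = ∫ z : ℂ, F (z.re, z.im) :=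
  (Complex.volume_preserving_equiv_real_prod.integral_comp' F).symm

theorem cauchyPhase_framePoint (A : E3 → E3) (t : ℝ) (w : ℂ) :
    cauchyPhase (b 1) (b 2) A (framePoint c b (t, w)) =
      cauchyT (fun z => -source (b 1) (b 2) A (framePoint c b (t, z))) w := by
  rw [cauchyPhase, cauchyT, ← integral_const_mul, integral_real_prod_eq,
    ← integral_sub_left_eq_self _ volume w]
  refine integral_congr_ae (Eventually.of_forall fun u => ?_)
  simp only [framePoint_sub, sub_sub_cancel, source, mul_comm Complex.I, Complex.re_add_im]
  ring

/-- Conjugation turns -γ₁ + iγ₂ into -(γ₁ + iγ₂), and the substitution s = -conj u turns the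
conjugated kernel into -1/u. These signs cancel and only conj(-i) = i is left, so the sign is
opposite to that of Φ₁⁰. -/
theorem conj_cauchyPhase_framePoint (A : E3 → E3) (t : ℝ) (w : ℂ) :
    (starRingEnd ℂ) (cauchyPhase (-b 1) (b 2) A (framePoint c b (t, w))) =
      cauchyT (fun z => source (b 1) (b 2) A (framePoint c b (t, z))) w := by
  have hζ : ∀ v : E3, (starRingEnd ℂ) (zeta (-b 1) (b 2) ⬝ᵥ toC v) =
      -(zeta (b 1) (b 2) ⬝ᵥ toC v) := fun v => by
    simp [dotProduct, zeta, toC, Fin.sum_univ_three]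
    ring
  have hs : ∀ u : ℂ, framePoint c b (t, w) - ((-(starRingEnd ℂ) u).re • -b 1 +
      (-(starRingEnd ℂ) u).im • b 2) = framePoint c b (t, w - u) := fun u => by
    rw [← framePoint_sub]
    simp
  rw [cauchyPhase, cauchyT, map_mul, ← integral_conj, ← integral_const_mul, integral_real_prod_eq,
    ← integral_neg_eq_self, ← Complex.conjLIE.measurePreserving.integral_comp
      Complex.conjLIE.toHomeomorph.measurableEmbedding,
    ← integral_sub_left_eq_self _ volume w]
  refine integral_congr_ae (Eventually.of_forall fun u => ?_)
  have h1 : Complex.conjLIE (w - u) = (starRingEnd ℂ) (w - u) := rfl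
  simp only [h1, hs, sub_sub_cancel]
  simp only [source, mul_comm Complex.I, Complex.re_add_im, map_div₀, map_mul, map_neg, hζ, Complex.conj_I, Complex.conj_conj, map_one, Complex.conj_ofReal, map_sub]
  have h2 : (starRingEnd ℂ) (2 : ℂ) = 2 := Complex.conj_ofNat 2
  rw [h2, div_neg]
  ring

theorem IsBoundedField.measurable_source (hD : IsBoundedField c r D) (γ₁ γ₂ : E3) :
    Measurable (source γ₁ γ₂ D) :=
  (hD.measurable_dotProduct _).const_mul _

theorem IsBoundedField.exists_norm_source_le (hD : IsBoundedField c r D) (γ₁ γ₂ : E3) :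
    ∃ M, ∀ x, ‖source γ₁ γ₂ D x‖ ≤ M := by
  obtain ⟨M, hM⟩ := hD.exists_norm_dotProduct_le (zeta γ₁ γ₂)
  refine ⟨‖Complex.I / (2 * Real.pi)‖ * M, fun x => ?_⟩
  rw [source, norm_mul]
  gcongr
  exact hM x

/-- The radius is allowed to be negative, in which case the field is zero; that case is separate
because squares cannot then be compared. -/
theorem IsBoundedField.source_framePoint_eq_zero (hD : IsBoundedField c r D) (γ₁ γ₂ : E3) {t : ℝ}
    {z : ℂ} (h : r < 0 ∨ r ^ 2 < t ^ 2 + ‖z‖ ^ 2) :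
    source γ₁ γ₂ D (framePoint c b (t, z)) = 0 := by
  rw [source, hD.dotProduct_eq_zero, mul_zero]
  rcases h with h | h
  · exact h.trans_le dist_nonneg
  · rw [← dist_framePoint_sq c b] at h
    exact lt_of_pow_lt_pow_left₀ 2 dist_nonneg h

theorem IsBoundedField.source_framePoint_eq_zero_of_norm (hD : IsBoundedField c r D)
    (γ₁ γ₂ : E3) {t : ℝ} {z : ℂ} (h : r < ‖z‖) :
    source γ₁ γ₂ D (framePoint c b (t, z)) = 0 := by
  refine hD.source_framePoint_eq_zero γ₁ γ₂ ((lt_or_ge r 0).imp_right fun h0 => ?_)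
  nlinarith [sq_nonneg t]

theorem IsBoundedField.isDensity_source (hD : IsBoundedField c r D) (γ₁ γ₂ : E3) (t : ℝ) :
    IsDensity fun z => source γ₁ γ₂ D (framePoint c b (t, z)) := by
  obtain ⟨M, hM⟩ := hD.exists_norm_source_le γ₁ γ₂
  exact ⟨(hD.measurable_source γ₁ γ₂).comp (measurable_framePoint.comp (by fun_prop)),
    ⟨M, fun z => hM _⟩, ⟨r, fun z hz => hD.source_framePoint_eq_zero_of_norm γ₁ γ₂ hz⟩⟩

/-- The two phases have opposite signs, so they combine into the transform of the very density that
the moment integrates. The integrand on each plane is therefore q e^{Tq}. -/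
theorem phaseSum_framePoint {A₁ A₂ : E3 → E3} (h₁ : IsBoundedField c r₁ (reflExt A₁))
    (h₂ : IsBoundedField c r₂ (reflExt A₂)) (t : ℝ) (w : ℂ) :
    phaseSum A₁ A₂ (b 1) (b 2) (framePoint c b (t, w)) =
      cauchyT (fun z => source (b 1) (b 2) (fun x => reflExt A₂ x - reflExt A₁ x)
        (framePoint c b (t, z))) w := by
  rw [phaseSum, cauchyPhase_framePoint, conj_cauchyPhase_framePoint]
  have i₁ := (h₁.isDensity_source (b := b) (b 1) (b 2) t).integrable_div_sub w
  have i₂ := (h₂.isDensity_source (b := b) (b 1) (b 2) t).integrable_div_sub w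
  simp only [cauchyT, neg_div, integral_neg]
  rw [neg_add_eq_sub, ← integral_sub i₂ i₁]
  refine integral_congr_ae (Eventually.of_forall fun z => ?_)
  have : ∀ u v : E3, toC (u - v) = toC u - toC v := fun u v => by ext; simp [toC]
  simp only [source, this, dotProduct_sub]
  ring

theorem phaseSum_eq_cauchyT {A₁ A₂ : E3 → E3} (h₁ : IsBoundedField c r₁ (reflExt A₁))
    (h₂ : IsBoundedField c r₂ (reflExt A₂)) (x : E3) :
    phaseSum A₁ A₂ (b 1) (b 2) x =
      cauchyT (fun z => source (b 1) (b 2) (fun x => reflExt A₂ x - reflExt A₁ x)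
        (framePoint c b (inner ℝ (b 0) (x - c), z))) (planeCoord c b x) := by
  rw [← phaseSum_framePoint h₁ h₂, framePoint_inner_planeCoord]

theorem measurable_phaseSum {A₁ A₂ : E3 → E3} (h₁ : IsBoundedField c r₁ (reflExt A₁))
    (h₂ : IsBoundedField c r₂ (reflExt A₂)) : Measurable (phaseSum A₁ A₂ (b 1) (b 2)) := by
  rw [funext (phaseSum_eq_cauchyT (b := b) h₁ h₂)]
  have hs := (h₁.sub h₂).measurable_source (b 1) (b 2)
  have hf : Measurable (framePoint c b) := measurable_framePoint
  have : Measurable (Function.uncurry fun (x : E3) (z : ℂ) =>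
      source (b 1) (b 2) (fun x => reflExt A₂ x - reflExt A₁ x)
        (framePoint c b (inner ℝ (b 0) (x - c), z)) / (planeCoord c b x - z)) := by
    refine (hs.comp (hf.comp (Continuous.measurable (by fun_prop)))).div
      (Continuous.measurable ?_)
    unfold planeCoord
    fun_prop
  exact this.stronglyMeasurable.integral_prod_right.measurable

theorem exists_norm_phaseSum_le {A₁ A₂ : E3 → E3} (h₁ : IsBoundedField c r₁ (reflExt A₁))
    (h₂ : IsBoundedField c r₂ (reflExt A₂)) :
    ∃ C, ∀ x, ‖phaseSum A₁ A₂ (b 1) (b 2) x‖ ≤ C := by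
  obtain ⟨M, hM⟩ := (h₁.sub h₂).exists_norm_source_le (b 1) (b 2)
  obtain ⟨C, hC⟩ := IsDensity.exists_forall_integral_norm_le M (max r₁ r₂)
  refine ⟨C, fun x => ?_⟩
  rw [phaseSum_eq_cauchyT h₁ h₂]
  exact (norm_integral_le_integral_norm _).trans (hC _
    ((h₁.sub h₂).isDensity_source (b := b) (b 1) (b 2) _).measurable (fun z => hM _)
    (fun z hz => (h₁.sub h₂).source_framePoint_eq_zero_of_norm _ _ hz) _)

end Phase

/-! ### Moments as Fourier transforms of plane integrals -/

section Moment

variable {c : E3} {b : OrthonormalBasis (Fin 3) ℝ E3} {r r₁ r₂ R : ℝ} {D A₁ A₂ : E3 → E3}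

/-- Measurable functions on a ball with values in a bounded set. -/
def IsWeight (c : E3) (R : ℝ) (w : E3 → ℂ) : Prop :=
  AEStronglyMeasurable w (volume.restrict (ball c R)) ∧ ∃ C, ∀ x ∈ ball c R, ‖w x‖ ≤ C

theorem IsWeight.mul {v w : E3 → ℂ} (hv : IsWeight c R v) (hw : IsWeight c R w) :
    IsWeight c R fun x => v x * w x := by
  obtain ⟨C, hC⟩ := hv.2
  obtain ⟨C', hC'⟩ := hw.2
  refine ⟨hv.1.mul hw.1, C * C', fun x hx => ?_⟩
  rw [norm_mul]
  exact mul_le_mul (hC x hx) (hC' x hx) (norm_nonneg _) ((norm_nonneg _).trans (hC x hx))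

theorem isWeight_of_continuousOn {w : E3 → ℂ} (hw : ContinuousOn w (closedBall c R)) :
    IsWeight c R w := by
  obtain ⟨C, hC⟩ := (isCompact_closedBall c R).exists_bound_of_continuousOn hw
  exact ⟨(hw.mono ball_subset_closedBall).aestronglyMeasurable measurableSet_ball, C,
    fun x hx => hC x (ball_subset_closedBall hx)⟩

theorem isWeight_exp_phaseSum (h₁ : IsBoundedField c r₁ (reflExt A₁))
    (h₂ : IsBoundedField c r₂ (reflExt A₂)) :
    IsWeight c R fun x => Complex.exp (phaseSum A₁ A₂ (b 1) (b 2) x) := by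
  obtain ⟨C, hC⟩ := exists_norm_phaseSum_le (b := b) h₁ h₂
  refine ⟨(Complex.measurable_exp.comp (measurable_phaseSum h₁ h₂)).aestronglyMeasurable,
    Real.exp C, fun x _ => ?_⟩
  rw [Complex.norm_exp]
  exact Real.exp_le_exp.2 ((Complex.re_le_norm _).trans (hC x))

theorem IsBoundedField.dotProduct_setIntegral (hD : IsBoundedField c r D) (hr : r < R)
    (v : Fin 3 → ℂ) {w : E3 → ℂ} (hw : IsWeight c R w) :
    (v ⬝ᵥ fun k => ∫ x in ball c R, toC (D x) k * w x) = ∫ x, (v ⬝ᵥ toC (D x)) * w x := by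
  rw [← setIntegral_eq_integral_of_forall_compl_eq_zero (s := ball c R)]
  · have hi : ∀ k, IntegrableOn (fun x => v k * (toC (D x) k * w x)) (ball c R) := fun k => by
      have := hD.integrable_dotProduct_mul hr (Pi.single k 1) hw.1 hw.2
      simp only [single_one_dotProduct] at this
      exact (this.const_mul (v k)).integrableOn
    simp only [dotProduct, Finset.sum_mul, mul_assoc, ← integral_const_mul]
    exact (integral_finsetSum _ fun k _ => hi k).symm
  · intro x hx
    rw [hD.dotProduct_eq_zero v (hr.trans_le (by simpa using hx)), zero_mul]

theorem IsBoundedField.integrable_source_mul (hD : IsBoundedField c r D) (hr : r < R)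
    (γ₁ γ₂ : E3) {w : E3 → ℂ} (hw : IsWeight c R w) :
    Integrable fun x => source γ₁ γ₂ D x * w x := by
  simp only [source, mul_assoc]
  exact (hD.integrable_dotProduct_mul hr (zeta γ₁ γ₂) hw.1 hw.2).const_mul _

theorem isWeight_exp_inner (c : E3) (R : ℝ) (ξ : E3) :
    IsWeight c R fun x => Complex.exp (Complex.I * (inner ℝ x ξ : ℝ)) :=
  isWeight_of_continuousOn (Continuous.continuousOn (by fun_prop))

/-- The moment as the Fourier transform of the integrals over the planes spanned by `γ₁`, `γ₂`. -/
theorem moment_eq (hD : IsBoundedField c r fun x => reflExt A₂ x - reflExt A₁ x) (hr : r < R)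
    {w : E3 → ℂ} (hw : IsWeight c R w) (τ : ℝ) :
    Complex.I / (2 * Real.pi) * moment c R A₁ A₂ (b 1) (b 2) (τ • b 0) w =
      Complex.exp (Complex.I * (inner ℝ c (τ • b 0) : ℝ)) *
        ∫ t : ℝ, (∫ z, source (b 1) (b 2) (fun x => reflExt A₂ x - reflExt A₁ x)
          (framePoint c b (t, z)) * w (framePoint c b (t, z))) *
          Complex.exp (Complex.I * (τ * t)) := by
  have h := hD.dotProduct_setIntegral hr (zeta (b 1) (b 2))
    (hw.mul (isWeight_exp_inner c R (τ • b 0)))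
  simp only [← mul_assoc] at h
  rw [moment, h, ← integral_mul_exp_eq (hD.integrable_source_mul hr (b 1) (b 2) hw),
    ← integral_const_mul, ← integral_const_mul]
  refine integral_congr_ae (Eventually.of_forall fun x => ?_)
  have he : Complex.exp (Complex.I * (inner ℝ x (τ • b 0) : ℝ)) =
      Complex.exp (Complex.I * (inner ℝ c (τ • b 0) : ℝ)) *
        Complex.exp (Complex.I * (τ * (inner ℝ (b 0) (x - c) : ℝ))) := by
    rw [← Complex.exp_add]
    congr 1
    simp only [inner_smul_right, inner_sub_right, real_inner_comm (b 0)]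
    push_cast
    ring
  simp only [he, source]
  ring

end Moment

/-! ### Amplitudes as holomorphic functions on planar slices -/

section Amplitude

variable {c : E3} {b : OrthonormalBasis (Fin 3) ℝ E3} {R : ℝ} {g : E3 → ℂ}

theorem IsAmplitude.isWeight {γ₁ γ₂ : E3} (hg : IsAmplitude c R γ₁ γ₂ g) : IsWeight c R g :=
  isWeight_of_continuousOn hg.1.continuousOn

theorem zeta_dotProduct_single (γ₁ γ₂ : E3) (L : E3 →L[ℝ] ℂ) :
    (zeta γ₁ γ₂ ⬝ᵥ fun k => L (EuclideanSpace.single k 1)) = L γ₁ + Complex.I * L γ₂ := by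
  have h : ∀ v : E3, L v = ∑ k, (v k : ℂ) * L (EuclideanSpace.single k 1) := fun v => by
    conv_lhs => rw [← (EuclideanSpace.basisFun (Fin 3) ℝ).sum_repr v]
    simp
  rw [h γ₁, h γ₂, dotProduct, Finset.mul_sum, ← Finset.sum_add_distrib]
  refine Finset.sum_congr rfl fun k _ => ?_
  simp only [zeta]
  ring

/-- The coordinate has gradient b₁ + ib₂, whose bilinear square is 1 + i² = 0. -/
theorem isAmplitude_planeCoord_pow (n : ℕ) :
    IsAmplitude c R (b 1) (b 2) fun x => planeCoord c b x ^ n := by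
  have hd : ∀ x, HasFDerivAt (planeCoord c b)
      (Complex.ofRealCLM ∘L innerSL ℝ (b 1) +
        Complex.I • (Complex.ofRealCLM ∘L innerSL ℝ (b 2))) x := fun x => by
    have h : ∀ v : E3, HasFDerivAt (fun x => ((inner ℝ v (x - c) : ℝ) : ℂ))
        (Complex.ofRealCLM ∘L innerSL ℝ v) x := fun v =>
      Complex.ofRealCLM.hasFDerivAt.comp x
        ((innerSL ℝ v).hasFDerivAt.comp x ((hasFDerivAt_id x).sub_const c))
    exact (h (b 1)).add ((h (b 2)).const_mul Complex.I)
  refine ⟨ContDiff.contDiffOn ?_, fun x _ => ?_⟩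
  · unfold planeCoord
    have : ∀ v : E3, ContDiff ℝ ∞ fun x : E3 => ((inner ℝ v (x - c) : ℝ) : ℂ) := fun v =>
      Complex.ofRealCLM.contDiff.comp
        (contDiff_const.inner ℝ (contDiff_id.sub contDiff_const))
    have h1 := this (b 1)
    have h2 := this (b 2)
    fun_prop
  · have : gradC (fun x => planeCoord c b x ^ n) x = fun k =>
        fderiv ℝ (fun x => planeCoord c b x ^ n) x (EuclideanSpace.single k 1) := rfl
    rw [this, zeta_dotProduct_single, ((hd x).pow n).fderiv]
    simp
    linear_combination (n * planeCoord c b x ^ (n - 1)) * Complex.I_mul_I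

/-- On the slice at height t the amplitude equation is the Cauchy–Riemann equation, and the slice of
the ball is this disc. -/
theorem IsAmplitude.differentiableOn_framePoint (hg : IsAmplitude c R (b 1) (b 2) g) (hR : 0 < R)
    (t : ℝ) : DifferentiableOn ℂ (fun z => g (framePoint c b (t, z)))
      (ball 0 √(R ^ 2 - t ^ 2)) := by
  intro z hz
  refine DifferentiableAt.differentiableWithinAt ?_
  have hz' : ‖z‖ ^ 2 < R ^ 2 - t ^ 2 := by
    rw [mem_ball_zero_iff] at hz
    exact (Real.lt_sqrt (norm_nonneg z)).1 hz
  have hmem : framePoint c b (t, z) ∈ ball c R := by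
    rw [mem_ball]
    refine lt_of_pow_lt_pow_left₀ 2 hR.le ?_
    rw [dist_framePoint_sq]
    linarith
  have hd : HasFDerivAt g (fderiv ℝ g (framePoint c b (t, z))) (framePoint c b (t, z)) :=
    ((hg.1.contDiffAt (mem_of_superset (isOpen_ball.mem_nhds hmem)
      ball_subset_closedBall)).differentiableAt (by simp)).hasFDerivAt
  have hf : HasFDerivAt (fun z => framePoint c b (t, z))
      (Complex.reCLM.smulRight (b 1) + Complex.imCLM.smulRight (b 2)) z := by
    unfold framePoint
    exact ((((Complex.reCLM.smulRight (b 1)).hasFDerivAt (x := z)).const_add (t • b 0)).add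
      ((Complex.imCLM.smulRight (b 2)).hasFDerivAt (x := z))).const_add c
  have hcomp := hd.comp z hf
  refine differentiableAt_complex_iff_differentiableAt_real.2 ⟨hcomp.differentiableAt, ?_⟩
  have hcr : fderiv ℝ g (framePoint c b (t, z)) (b 1) +
      Complex.I * fderiv ℝ g (framePoint c b (t, z)) (b 2) = 0 := by
    rw [← zeta_dotProduct_single]
    exact hg.2 _ hmem
  have hfd : fderiv ℝ (fun z => g (framePoint c b (t, z))) z = _ := hcomp.fderiv
  rw [hfd]
  simp
  rw [eq_neg_of_add_eq_zero_left hcr, mul_neg, ← mul_assoc, Complex.I_mul_I]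
  ring

end Amplitude

end MagneticHalfSpace

namespace MagneticHalfSpace

open Filter Topology CauchyTransform

/-! ### Admissible frames -/

section Frame

theorem Admissible.exists_frame {γ₁ γ₂ ξ : E3} (h : Admissible γ₁ γ₂ ξ) :
    ∃ b : OrthonormalBasis (Fin 3) ℝ E3, b 1 = γ₁ ∧ b 2 = γ₂ := by
  obtain ⟨h1, h2, h12, -⟩ := h
  have ho : Orthonormal ℝ (({1, 2} : Set (Fin 3)).domRestrict ![0, γ₁, γ₂]) := by
    constructor
    · rintro ⟨i, rfl | rfl⟩
      · exact h1
      · exact h2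
    · rintro ⟨i, rfl | rfl⟩ ⟨j, rfl | rfl⟩ hij
      · exact absurd rfl hij
      · exact h12
      · exact (real_inner_comm _ _).trans h12
      · exact absurd rfl hij
  obtain ⟨b, hb⟩ := ho.exists_orthonormalBasis_extension_of_card_eq (by simp)
  exact ⟨b, hb 1 (by simp), hb 2 (by simp)⟩

theorem Admissible.eq_smul {b : OrthonormalBasis (Fin 3) ℝ E3} {ξ : E3}
    (h : Admissible (b 1) (b 2) ξ) : ξ = (inner ℝ (b 0) ξ : ℝ) • b 0 := by
  obtain ⟨-, -, -, h1, h2, -⟩ := h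
  conv_lhs => rw [← b.sum_repr' ξ, Fin.sum_univ_three, h1, h2]
  simp

/-- A vector orthogonal to the admissible frames of a direction `ξ` that is not vertical is a
multiple of `ξ`. -/
theorem exists_eq_mul_of_forall_admissible {F : Fin 3 → ℂ} {ξ : E3}
    (hξ : 0 < ξ 0 ^ 2 + ξ 1 ^ 2)
    (h : ∀ γ₁ γ₂ : E3, Admissible γ₁ γ₂ ξ → zeta γ₁ γ₂ ⬝ᵥ F = 0) :
    ∃ a : ℂ, ∀ k, F k = a * ξ k := by
  set p := ξ 0 ^ 2 + ξ 1 ^ 2 with hp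
  set n := √p
  set m := √(p + ξ 2 ^ 2)
  have hn2 : n ^ 2 = p := Real.sq_sqrt hξ.le
  have hm2 : m ^ 2 = p + ξ 2 ^ 2 := Real.sq_sqrt (by positivity)
  have hn : 0 < n := Real.sqrt_pos.2 hξ
  have hm : 0 < m := Real.sqrt_pos.2 (by positivity)
  -- γ₁ is the rotated horizontal part of ξ, normalised, and ±γ₂ is the unit normal to both γ₁ and
  -- ξ. Adding and subtracting the equations for the two signs separates γ₁·F = 0 from γ₂·F = 0.
  have hadm : ∀ ε : ℝ, ε ^ 2 = 1 → Admissible !₂[-ξ 1 / n, ξ 0 / n, 0]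
      !₂[ε * (ξ 2 * ξ 0 / (n * m)), ε * (ξ 2 * ξ 1 / (n * m)), ε * (-p / (n * m))] ξ := by
    intro ε hε
    have hε0 : ε ≠ 0 := by rintro rfl; norm_num at hε
    have hnorm : ∀ v : E3, v 0 ^ 2 + v 1 ^ 2 + v 2 ^ 2 = 1 → ‖v‖ = 1 := fun v hv => by
      rw [EuclideanSpace.norm_eq, Fin.sum_univ_three]
      simp [hv]
    refine ⟨hnorm _ ?_, hnorm _ ?_, ?_, ?_, ?_, ?_, ?_⟩
    · simp
      field_simp
      rw [hn2]
      ring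
    · simp
      field_simp
      rw [hε, hn2, hm2]
      ring
    · simp [PiLp.inner_apply, Fin.sum_univ_three]
      ring
    · simp [PiLp.inner_apply, Fin.sum_univ_three]
      ring
    · simp [PiLp.inner_apply, Fin.sum_univ_three, hp]
      ring
    · simp
    · simp [hε0, hξ.ne', hn.ne', hm.ne']
  have hpC : ((ξ 0 : ℂ) ^ 2 + (ξ 1 : ℂ) ^ 2) ≠ 0 := by
    have : (p : ℂ) ≠ 0 := Complex.ofReal_ne_zero.2 hξ.ne'
    simpa only [hp, Complex.ofReal_add, Complex.ofReal_pow] using this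
  have hnC : (n : ℂ) ≠ 0 := by exact_mod_cast hn.ne'
  have hmC : (m : ℂ) ≠ 0 := by exact_mod_cast hm.ne'
  have e1 := h _ _ (hadm 1 (by norm_num))
  have e2 := h _ _ (hadm (-1) (by norm_num))
  simp [dotProduct, zeta, Fin.sum_univ_three, hp] at e1 e2
  have f1 : (ξ 0 : ℂ) * F 1 = ξ 1 * F 0 := by
    have h3 : (-(ξ 1 : ℂ) / n * F 0 + ξ 0 / n * F 1) = 0 := by
      linear_combination (e1 + e2) / 2
    field_simp at h3
    linear_combination h3
  have f2 : (ξ 2 : ℂ) * (ξ 0 * F 0 + ξ 1 * F 1) = (ξ 0 ^ 2 + ξ 1 ^ 2) * F 2 := by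
    have : (2 : ℂ) * Complex.I * (ξ 2 * ξ 0 / (n * m) * F 0 + ξ 2 * ξ 1 / (n * m) * F 1
        - (ξ 0 ^ 2 + ξ 1 ^ 2) / (n * m) * F 2) = 0 := by
      linear_combination e1 - e2
    have h3 := (mul_eq_zero.1 this).resolve_left (by simp)
    field_simp at h3
    linear_combination h3
  refine ⟨(ξ 0 * F 0 + ξ 1 * F 1) / (ξ 0 ^ 2 + ξ 1 ^ 2), fun k => ?_⟩
  fin_cases k
  · simp
    field_simp
    linear_combination -(ξ 1 : ℂ) * f1
  · simp
    field_simp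
    linear_combination (ξ 0 : ℂ) * f1
  · simp
    field_simp
    linear_combination -f2

end Frame

/-! ### Vanishing planar moments and vanishing of the moments with amplitudes -/

section Vanishing

variable {c : E3} {b : OrthonormalBasis (Fin 3) ℝ E3} {r r₁ r₂ R : ℝ} {D A₁ A₂ : E3 → E3}

/-- In almost every plane spanned by `b 1`, `b 2` the source is orthogonal to the holomorphic
polynomials. -/
def PlanarMomentsVanish (c : E3) (b : OrthonormalBasis (Fin 3) ℝ E3) (D : E3 → E3) : Prop :=
  ∀ᵐ t : ℝ, ∀ n : ℕ, ∫ z, source (b 1) (b 2) D (framePoint c b (t, z)) * z ^ n = 0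

/-- A nonzero density sits in the disc of radius √(r² - t²), strictly inside the disc of radius √(R²
- t²) on which g is holomorphic. Leaving `q` general covers the source with and without its
exponential factor. -/
theorem integral_mul_amplitude_eq_zero (hD : IsBoundedField c r D) (hr : r < R) (hR : 0 < R)
    {g : E3 → ℂ} (hg : IsAmplitude c R (b 1) (b 2) g) {t : ℝ} {q : ℂ → ℂ} (hq : IsDensity q)
    (hsupp : ∀ z, source (b 1) (b 2) D (framePoint c b (t, z)) = 0 → q z = 0)
    (h : ∀ n : ℕ, ∫ z, q z * z ^ n = 0) : ∫ z, q z * g (framePoint c b (t, z)) = 0 := by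
  have hs : ∀ z, r < 0 ∨ r ^ 2 < t ^ 2 + ‖z‖ ^ 2 → q z = 0 := fun z hz =>
    hsupp z (hD.source_framePoint_eq_zero (b 1) (b 2) hz)
  by_cases ht : r < 0 ∨ r ^ 2 < t ^ 2
  · have : ∀ z, q z = 0 := fun z => hs z (ht.imp_right fun h => by nlinarith [sq_nonneg ‖z‖])
    simp [this]
  · push Not at ht
    refine hq.integral_mul_eq_zero_of_differentiableOn h (ρ := √(r ^ 2 - t ^ 2))
      (Real.sqrt_lt_sqrt (by linarith) (by nlinarith)) (fun z hz => hs z (Or.inr ?_))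
      (hg.differentiableOn_framePoint hR t)
    rw [Real.sqrt_lt' ((Real.sqrt_nonneg _).trans_lt hz)] at hz
    linarith

variable (h₁ : IsBoundedField c r₁ (reflExt A₁)) (h₂ : IsBoundedField c r₂ (reflExt A₂))
  (hr₁ : r₁ < R) (hr₂ : r₂ < R)

include h₁ h₂ hr₁ hr₂

theorem moment_eq_zero_of_forall_plane {w : E3 → ℂ} (hw : IsWeight c R w) (τ : ℝ)
    (h : ∀ᵐ t : ℝ, ∫ z, source (b 1) (b 2) (fun x => reflExt A₂ x - reflExt A₁ x)
      (framePoint c b (t, z)) * w (framePoint c b (t, z)) = 0) :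
    moment c R A₁ A₂ (b 1) (b 2) (τ • b 0) w = 0 := by
  have hm := moment_eq (b := b) (h₁.sub h₂) (max_lt hr₁ hr₂) hw τ
  have h0 : ∫ t : ℝ, (∫ z, source (b 1) (b 2) (fun x => reflExt A₂ x - reflExt A₁ x)
      (framePoint c b (t, z)) * w (framePoint c b (t, z))) *
        Complex.exp (Complex.I * (τ * t)) = 0 := by
    refine integral_eq_zero_of_ae ?_
    filter_upwards [h] with t ht
    rw [ht, zero_mul, Pi.zero_apply]
  rw [h0, mul_zero] at hm
  exact (mul_eq_zero.1 hm).resolve_left (by simp [Real.pi_ne_zero])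

theorem ae_plane_eq_zero_of_moment {w : E3 → ℂ} (hw : IsWeight c R w)
    (h : ∀ τ : ℝ, moment c R A₁ A₂ (b 1) (b 2) (τ • b 0) w = 0) :
    ∀ᵐ t : ℝ, ∫ z, source (b 1) (b 2) (fun x => reflExt A₂ x - reflExt A₁ x)
      (framePoint c b (t, z)) * w (framePoint c b (t, z)) = 0 := by
  refine ae_eq_zero_of_integral_mul_exp_eq_zero (integrable_integral_framePoint
    ((h₁.sub h₂).integrable_source_mul (max_lt hr₁ hr₂) (b 1) (b 2) hw)) fun τ _ => ?_
  have hm := moment_eq (b := b) (h₁.sub h₂) (max_lt hr₁ hr₂) hw τ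
  rw [h τ, mul_zero] at hm
  exact (mul_eq_zero.1 hm.symm).resolve_left (Complex.exp_ne_zero _)

/-- On every plane ∫ q e^{Tq} = ∫ q, so the two Fourier transforms agree at each frequency
separately. -/
theorem moment_exp_phaseSum_eq (τ : ℝ) :
    moment c R A₁ A₂ (b 1) (b 2) (τ • b 0)
        (fun x => Complex.exp (phaseSum A₁ A₂ (b 1) (b 2) x)) =
      moment c R A₁ A₂ (b 1) (b 2) (τ • b 0) fun _ => 1 := by
  have hD := h₁.sub h₂
  have hR := max_lt hr₁ hr₂
  refine mul_left_cancel₀ (a := Complex.I / (2 * Real.pi)) (by simp [Real.pi_ne_zero]) ?_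
  rw [moment_eq hD hR (isWeight_exp_phaseSum h₁ h₂),
    moment_eq hD hR (isWeight_of_continuousOn continuousOn_const)]
  simp only [phaseSum_framePoint h₁ h₂, mul_one,
    (hD.isDensity_source (b := b) (b 1) (b 2) _).integral_mul_exp_cauchyT]

theorem PlanarMomentsVanish.moment_eq_zero (hR : 0 < R)
    (h : PlanarMomentsVanish c b fun x => reflExt A₂ x - reflExt A₁ x)
    {g : E3 → ℂ} (hg : IsAmplitude c R (b 1) (b 2) g) (τ : ℝ) :
    moment c R A₁ A₂ (b 1) (b 2) (τ • b 0) g = 0 := by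
  refine moment_eq_zero_of_forall_plane h₁ h₂ hr₁ hr₂ hg.isWeight τ ?_
  filter_upwards [h] with t ht
  exact integral_mul_amplitude_eq_zero (h₁.sub h₂) (max_lt hr₁ hr₂) hR hg
    ((h₁.sub h₂).isDensity_source (b 1) (b 2) t) (fun _ => id) ht

theorem PlanarMomentsVanish.moment_exp_eq_zero (hR : 0 < R)
    (h : PlanarMomentsVanish c b fun x => reflExt A₂ x - reflExt A₁ x)
    {g : E3 → ℂ} (hg : IsAmplitude c R (b 1) (b 2) g) (τ : ℝ) :
    moment c R A₁ A₂ (b 1) (b 2) (τ • b 0)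
      (fun x => g x * Complex.exp (phaseSum A₁ A₂ (b 1) (b 2) x)) = 0 := by
  refine moment_eq_zero_of_forall_plane h₁ h₂ hr₁ hr₂
    (hg.isWeight.mul (isWeight_exp_phaseSum h₁ h₂)) τ ?_
  filter_upwards [h] with t ht
  have hd := (h₁.sub h₂).isDensity_source (b := b) (b 1) (b 2) t
  have := integral_mul_amplitude_eq_zero (h₁.sub h₂) (max_lt hr₁ hr₂) hR hg
    hd.mul_exp_cauchyT (fun z hz => by rw [hz, zero_mul]) (hd.forall_moment_exp_eq_zero_iff.2 ht)
  rw [← this]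
  refine integral_congr_ae (Eventually.of_forall fun z => ?_)
  simp only [phaseSum_framePoint h₁ h₂]
  ring

/-- The amplitudes zⁿ are used, Fourier inversion in τ localises to almost every plane
simultaneously for all n, and the exponential is then removed from the whole sequence of moments. -/
theorem planarMomentsVanish_of_amplitudes
    (h : ∀ τ : ℝ, ∀ g, IsAmplitude c R (b 1) (b 2) g →
      moment c R A₁ A₂ (b 1) (b 2) (τ • b 0)
        (fun x => g x * Complex.exp (phaseSum A₁ A₂ (b 1) (b 2) x)) = 0) :
    PlanarMomentsVanish c b fun x => reflExt A₂ x - reflExt A₁ x := by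
  have hn : ∀ᵐ t : ℝ, ∀ n : ℕ, ∫ z, source (b 1) (b 2) (fun x => reflExt A₂ x - reflExt A₁ x)
      (framePoint c b (t, z)) * (planeCoord c b (framePoint c b (t, z)) ^ n *
        Complex.exp (phaseSum A₁ A₂ (b 1) (b 2) (framePoint c b (t, z)))) = 0 :=
    ae_all_iff.2 fun n => ae_plane_eq_zero_of_moment h₁ h₂ hr₁ hr₂
      ((isAmplitude_planeCoord_pow n).isWeight.mul (isWeight_exp_phaseSum h₁ h₂))
      fun τ => h τ _ (isAmplitude_planeCoord_pow n)
  filter_upwards [hn] with t ht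
  refine ((h₁.sub h₂).isDensity_source (b 1) (b 2) t).forall_moment_exp_eq_zero_iff.1 fun n => ?_
  rw [← ht n]
  refine integral_congr_ae (Eventually.of_forall fun z => ?_)
  simp only [phaseSum_framePoint h₁ h₂, planeCoord_framePoint]
  ring

end Vanishing

/-! ### Curl-free fields and complex frequencies -/

section Curl

variable {c : E3} {b : OrthonormalBasis (Fin 3) ℝ E3} {r R : ℝ} {D : E3 → E3}

/-- The Fourier transform of the component along `v` of the field, at the complex frequency with
coordinates `τ`, `α`, `β` in the frame. -/
noncomputable def complexFourier (b : OrthonormalBasis (Fin 3) ℝ E3) (D : E3 → E3)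
    (v : Fin 3 → ℂ) (τ : ℝ) (α β : ℂ) : ℂ :=
  ∫ x, (v ⬝ᵥ toC (D x)) * (Complex.exp (Complex.I * (τ * (inner ℝ (b 0) x : ℝ))) *
    Complex.exp (α * (Complex.I * (inner ℝ (b 1) x : ℝ))) *
    Complex.exp (β * (Complex.I * (inner ℝ (b 2) x : ℝ))))

theorem norm_I_mul_inner_le (hD : IsBoundedField c r D) (v : Fin 3 → ℂ) (w : E3 → ℂ)
    (i : Fin 3) (x : E3) (hx : (v ⬝ᵥ toC (D x)) * w x ≠ 0) :
    ‖Complex.I * (inner ℝ (b i) x : ℝ)‖ ≤ r + ‖c‖ := by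
  have hxr : dist x c ≤ r := by
    by_contra h
    exact left_ne_zero_of_mul hx (hD.dotProduct_eq_zero v (not_le.1 h))
  rw [norm_mul, Complex.norm_I, one_mul, Complex.norm_real]
  refine (norm_inner_le_norm (b i) x).trans ?_
  rw [b.norm_eq_one, one_mul]
  have := norm_sub_norm_le x c
  rw [dist_eq_norm] at hxr
  linarith

theorem differentiable_complexFourier_right (hD : IsBoundedField c r D) (v : Fin 3 → ℂ) (τ : ℝ)
    (α : ℂ) : Differentiable ℂ fun β => complexFourier b D v τ α β := fun β => by
  have hi := hD.integrable_dotProduct_mul (lt_add_one r) v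
    (isWeight_of_continuousOn (c := c) (R := r + 1) (Continuous.continuousOn (by fun_prop :
      Continuous fun x : E3 => Complex.exp (Complex.I * (τ * (inner ℝ (b 0) x : ℝ))) *
        Complex.exp (α * (Complex.I * (inner ℝ (b 1) x : ℝ)))))).1
    (isWeight_of_continuousOn (Continuous.continuousOn (by fun_prop))).2
  have := (hasDerivAt_integral_mul_exp hi (Continuous.aestronglyMeasurable (by fun_prop))
    (norm_I_mul_inner_le (b := b) hD v _ 2) β).differentiableAt
  refine this.congr_of_eventuallyEq (Eventually.of_forall fun β => ?_)
  simp only [complexFourier, mul_assoc]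

theorem differentiable_complexFourier_left (hD : IsBoundedField c r D) (v : Fin 3 → ℂ) (τ : ℝ)
    (β : ℂ) : Differentiable ℂ fun α => complexFourier b D v τ α β := fun α => by
  have hi := hD.integrable_dotProduct_mul (lt_add_one r) v
    (isWeight_of_continuousOn (c := c) (R := r + 1) (Continuous.continuousOn (by fun_prop :
      Continuous fun x : E3 => Complex.exp (Complex.I * (τ * (inner ℝ (b 0) x : ℝ))) *
        Complex.exp (β * (Complex.I * (inner ℝ (b 2) x : ℝ)))))).1
    (isWeight_of_continuousOn (Continuous.continuousOn (by fun_prop))).2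
  have := (hasDerivAt_integral_mul_exp hi (Continuous.aestronglyMeasurable (by fun_prop))
    (norm_I_mul_inner_le (b := b) hD v _ 1) α).differentiableAt
  refine this.congr_of_eventuallyEq (Eventually.of_forall fun α => ?_)
  refine integral_congr_ae (Eventually.of_forall fun x => ?_)
  ring

theorem complexFourier_ofReal (hD : IsBoundedField c r D) (hr : r < R) (v : Fin 3 → ℂ)
    (τ α β : ℝ) : complexFourier b D v τ α β = v ⬝ᵥ fun k => ∫ x in ball c R,
      toC (D x) k * Complex.exp (Complex.I * (inner ℝ x (τ • b 0 + α • b 1 + β • b 2) : ℝ)) := by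
  rw [hD.dotProduct_setIntegral hr v (isWeight_exp_inner c R _), complexFourier]
  refine integral_congr_ae (Eventually.of_forall fun x => ?_)
  simp only [← Complex.exp_add]
  congr 2
  simp only [inner_add_right, inner_smul_right, real_inner_comm x]
  push_cast
  ring

/-- If the Fourier transform of `D` is parallel to `ξ` for all real frequencies `ξ` with nonzero
`b 1` coordinate, then this persists for complex frequencies. -/
theorem complexFourier_zeta_eq_zero (hD : IsBoundedField c r D) (hr : r < R)
    (h : ∀ τ α β : ℝ, α ≠ 0 → ∃ a : ℂ, ∀ k, ∫ x in ball c R, toC (D x) k *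
      Complex.exp (Complex.I * (inner ℝ x (τ • b 0 + α • b 1 + β • b 2) : ℝ)) =
        a * (τ • b 0 + α • b 1 + β • b 2) k) (τ : ℝ) (hτ : τ ≠ 0) (l : ℂ) :
    complexFourier b D (zeta (b 1) (b 2)) τ l (l * Complex.I) = 0 := by
  -- If F = aξ and ζ = b₁ + ib₂, then b₀·ξ = τ and ζ·ξ = α + iβ, so τ(ζ·F) = (ζ·ξ)(b₀·F). Both sides
  -- are entire in α and in β. The relation is continued in β for fixed real α ≠ 0, then in α; at β
  -- = iα the factor α + iβ vanishes.
  set G : ℂ → ℂ → ℂ := fun α β => τ * complexFourier b D (zeta (b 1) (b 2)) τ α β -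
    (α + Complex.I * β) * complexFourier b D (toC (b 0)) τ α β with hG
  have hreal : ∀ α β : ℝ, α ≠ 0 → G α β = 0 := fun α β hα => by
    obtain ⟨a, ha⟩ := h τ α β hα
    have hdot : ∀ v : E3, toC v ⬝ᵥ toC (τ • b 0 + α • b 1 + β • b 2) =
        (inner ℝ v (τ • b 0 + α • b 1 + β • b 2) : ℝ) := fun v => by
      simp [dotProduct, toC, PiLp.inner_apply, Fin.sum_univ_three, mul_comm]
    have hζ : zeta (b 1) (b 2) = toC (b 1) + Complex.I • toC (b 2) := by
      ext
      simp [zeta, toC]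
    have hF : (fun k => ∫ x in ball c R, toC (D x) k *
        Complex.exp (Complex.I * (inner ℝ x (τ • b 0 + α • b 1 + β • b 2) : ℝ))) =
        a • toC (τ • b 0 + α • b 1 + β • b 2) := funext ha
    simp only [hG, complexFourier_ofReal hD hr, hF, hζ, add_dotProduct, smul_dotProduct,
      dotProduct_smul, hdot]
    simp [inner_add_right, inner_smul_right]
    ring
  have hright : ∀ (α : ℝ) (β : ℂ), α ≠ 0 → G α β = 0 := fun α β hα => by
    refine eq_zero_of_differentiable_of_real (F := fun β => G α β) ?_ (fun s _ => hreal α s hα) β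
    have h1 := differentiable_complexFourier_right (b := b) hD (zeta (b 1) (b 2)) τ α
    have h2 := differentiable_complexFourier_right (b := b) hD (toC (b 0)) τ α
    simp only [hG]
    fun_prop
  have hleft : ∀ α β : ℂ, G α β = 0 := fun α β => by
    refine eq_zero_of_differentiable_of_real (F := fun α => G α β) ?_ (fun s hs => hright s β hs) α
    have h1 := differentiable_complexFourier_left (b := b) hD (zeta (b 1) (b 2)) τ β
    have h2 := differentiable_complexFourier_left (b := b) hD (toC (b 0)) τ β
    simp only [hG]
    fun_prop
  have := hleft l (l * Complex.I)
  have hz : l + Complex.I * (l * Complex.I) = 0 := by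
    linear_combination l * Complex.I_mul_I
  simp only [hG, hz, zero_mul, sub_zero] at this
  exact (mul_eq_zero.1 this).resolve_left (by exact_mod_cast hτ)

/-- At the frequency (τ, l, il) the exponential is, up to a constant from the origin, e^{iτt}
e^{liz}, a generating function in l of the moments of (iz)ⁿ. Fourier uniqueness in τ then passes to
single planes; τ = 0 is not needed. -/
theorem planarMomentsVanish_of_complexFourier (hD : IsBoundedField c r D)
    (h : ∀ τ : ℝ, τ ≠ 0 → ∀ l : ℂ,
      complexFourier b D (zeta (b 1) (b 2)) τ l (l * Complex.I) = 0) :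
    PlanarMomentsVanish c b D := by
  refine ae_all_iff.2 fun n => ?_
  have hpow : IsWeight c (r + 1) fun x => planeCoord c b x ^ n :=
    (isAmplitude_planeCoord_pow n).isWeight
  have hae := ae_integral_framePoint_eq_zero (c := c) (b := b)
    (hD.integrable_source_mul (lt_add_one r) (b 1) (b 2) hpow) fun τ hτ => ?_
  · filter_upwards [hae] with t ht
    simpa only [planeCoord_framePoint] using ht
  have hcont : Continuous (planeCoord c b) := by
    unfold planeCoord
    fun_prop
  have hw : IsWeight c (r + 1) fun x =>
      Complex.exp (Complex.I * (τ * (inner ℝ (b 0) (x - c) : ℝ))) :=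
    isWeight_of_continuousOn (Continuous.continuousOn (by fun_prop))
  obtain ⟨C, hC⟩ := (isWeight_of_continuousOn (c := c) (R := r + 1) hcont.continuousOn).2
  have hm := integral_mul_pow_eq_zero
    (hD.integrable_dotProduct_mul (lt_add_one r) (zeta (b 1) (b 2)) hw.1 hw.2)
    (θ := fun x => Complex.I * planeCoord c b x) (C := C)
    (Continuous.aestronglyMeasurable (by fun_prop)) (fun x hx => ?_) (fun l => ?_) n
  · have hI : (Complex.I / (2 * Real.pi)) * Complex.I ^ n ≠ 0 := by simp [Real.pi_ne_zero]
    refine (mul_eq_zero.1 (?_ : Complex.I ^ n * _ = 0)).resolve_left (by simp)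
    rw [← mul_zero (Complex.I / (2 * Real.pi)), ← hm, ← integral_const_mul, ← integral_const_mul]
    refine integral_congr_ae (Eventually.of_forall fun x => ?_)
    simp only [source]
    ring
  · rw [norm_mul, Complex.norm_I, one_mul]
    refine hC x ?_
    by_contra hxr
    refine left_ne_zero_of_mul hx (hD.dotProduct_eq_zero _ ?_)
    have := not_lt.1 (mt mem_ball.2 hxr)
    linarith
  · have hl := h τ hτ l
    rw [complexFourier] at hl
    -- This constant moves the origin of the coordinates from 0 to `c`.
    rw [← mul_zero (Complex.exp (-(Complex.I * (τ * (inner ℝ (b 0) c : ℝ)) +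
      l * (Complex.I * ((inner ℝ (b 1) c : ℝ) + Complex.I * (inner ℝ (b 2) c : ℝ)))))), ← hl,
      ← integral_const_mul]
    refine integral_congr_ae (Eventually.of_forall fun x => ?_)
    simp only [mul_assoc, mul_left_comm _ (_ ⬝ᵥ _), ← Complex.exp_add]
    congr 2
    simp only [planeCoord, inner_sub_right]
    push_cast
    ring

end Curl

end MagneticHalfSpace

/-! ### The three implications -/

theorem mainTheorem5 (c : E3) (R : ℝ) (hc : c 2 = 0) (hR : 0 < R)
    (A₁ A₂ : E3 → E3) (hA₁ : MemW1InfComp A₁) (hA₂ : MemW1InfComp A₂)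
    (hn₁ : ∀ x : E3, x 2 = 0 → A₁ x 2 = 0) (hn₂ : ∀ x : E3, x 2 = 0 → A₂ x 2 = 0)
    (hB₁ : lowerSupport A₁ ⊆ Metric.ball c R) (hB₂ : lowerSupport A₂ ⊆ Metric.ball c R) :
    -- the equality with the factor `e^Ψ` implies the equality without it
    (∀ γ₁ γ₂ ξ : E3, Admissible γ₁ γ₂ ξ →
      moment c R A₁ A₂ γ₁ γ₂ ξ (fun x => Complex.exp (phaseSum A₁ A₂ γ₁ γ₂ x)) = 0 →
      moment c R A₁ A₂ γ₁ γ₂ ξ (fun _ => 1) = 0) ∧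
    -- the equality with the factor `e^Ψ` then holds with arbitrary amplitudes `g`
    ((∀ γ₁ γ₂ ξ : E3, Admissible γ₁ γ₂ ξ →
        moment c R A₁ A₂ γ₁ γ₂ ξ (fun x => Complex.exp (phaseSum A₁ A₂ γ₁ γ₂ x)) = 0) →
      ∀ γ₁ γ₂ ξ : E3, Admissible γ₁ γ₂ ξ → ∀ g : E3 → ℂ, IsAmplitude c R γ₁ γ₂ g →
        moment c R A₁ A₂ γ₁ γ₂ ξ
          (fun x => g x * Complex.exp (phaseSum A₁ A₂ γ₁ γ₂ x)) = 0) ∧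
    -- with arbitrary amplitudes the factor can be removed for each pair `γ₁, γ₂` separately
    (∀ γ₁ γ₂ : E3,
      (∀ ξ : E3, Admissible γ₁ γ₂ ξ → ∀ g : E3 → ℂ, IsAmplitude c R γ₁ γ₂ g →
        moment c R A₁ A₂ γ₁ γ₂ ξ
          (fun x => g x * Complex.exp (phaseSum A₁ A₂ γ₁ γ₂ x)) = 0) →
      ∀ ξ : E3, Admissible γ₁ γ₂ ξ → ∀ g : E3 → ℂ, IsAmplitude c R γ₁ γ₂ g →
        moment c R A₁ A₂ γ₁ γ₂ ξ g = 0) := by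
  obtain ⟨r₁, hr₁, h₁⟩ := exists_isBoundedField_reflExt hc hA₁ hB₁
  obtain ⟨r₂, hr₂, h₂⟩ := exists_isBoundedField_reflExt hc hA₂ hB₂
  have hD := h₁.sub h₂
  have hr := max_lt hr₁ hr₂
  have hrem : ∀ γ₁ γ₂ ξ : E3, Admissible γ₁ γ₂ ξ →
      moment c R A₁ A₂ γ₁ γ₂ ξ (fun x => Complex.exp (phaseSum A₁ A₂ γ₁ γ₂ x)) = 0 →
      moment c R A₁ A₂ γ₁ γ₂ ξ (fun _ => 1) = 0 := by
    intro γ₁ γ₂ ξ hadm h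
    obtain ⟨b, rfl, rfl⟩ := hadm.exists_frame
    rw [hadm.eq_smul] at h ⊢
    rwa [moment_exp_phaseSum_eq h₁ h₂ hr₁ hr₂] at h
  refine ⟨hrem, fun h γ₁ γ₂ ξ hadm g hg => ?_, fun γ₁ γ₂ h ξ hadm g hg => ?_⟩
  · obtain ⟨b, rfl, rfl⟩ := hadm.exists_frame
    rw [hadm.eq_smul]
    refine PlanarMomentsVanish.moment_exp_eq_zero h₁ h₂ hr₁ hr₂ hR
      (planarMomentsVanish_of_complexFourier hD
        (complexFourier_zeta_eq_zero hD hr fun τ α β hα => ?_)) hg _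
    refine exists_eq_mul_of_forall_admissible ?_ fun γ₁ γ₂ hγ => ?_
    -- The frequency is not vertical: b₁ is horizontal and its inner product with the frequency is α
    -- ≠ 0.
    · have hb : b 1 2 = 0 := hadm.2.2.2.2.2.1
      have hin : inner ℝ (b 1) (τ • b 0 + α • b 1 + β • b 2) = α := by
        simp [inner_add_right, inner_smul_right]
      rw [PiLp.inner_apply, Fin.sum_univ_three, hb] at hin
      by_contra hle
      set ξ' := τ • b 0 + α • b 1 + β • b 2
      have h0 : ξ' 0 = 0 := by nlinarith [sq_nonneg (ξ' 0), sq_nonneg (ξ' 1)]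
      have h1 : ξ' 1 = 0 := by nlinarith [sq_nonneg (ξ' 0), sq_nonneg (ξ' 1)]
      rw [h0, h1] at hin
      simp at hin
      exact hα hin.symm
    · simpa only [moment, mul_one] using hrem _ _ _ hγ (h _ _ _ hγ)
  · obtain ⟨b, rfl, rfl⟩ := hadm.exists_frame
    rw [hadm.eq_smul]
    refine PlanarMomentsVanish.moment_eq_zero h₁ h₂ hr₁ hr₂ hR
      (planarMomentsVanish_of_amplitudes h₁ h₂ hr₁ hr₂ fun τ g hg => h _ ?_ g hg) hg _
    obtain ⟨e1, e2, e3, -, -, e4, e5⟩ := hadm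
    -- Admissibility does not constrain the length of ξ, so every multiple of b₀ is available for
    -- Fourier inversion.
    exact ⟨e1, e2, e3, by simp [inner_smul_right], by simp [inner_smul_right], e4, e5⟩
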